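/- **Setting.** Let $d\ge 1$ be an integer, let $L,T>0$, and let $\mathbb T^d$ be the torus obtained from $[0,L]^d$ by identifying opposite sides. Let $\mathsf C^k$ be the space of functions on $\mathbb T^d$ all of whose partial derivatives of order at most $k$ exist and are continuous (including at the periodic boundaries), let $\|f\|_{\mathsf L^2}=\big(\int_{\mathbb T^d}|f|^2\,dx\big)^{1/2}$, $\|f\|_{\mathsf L^\infty}=\max_{\mathbb T^d}|f|$, and let $\nabla^{2m}$ denote the Laplacian applied $m$ times. Let $(p_t)_{t\in[0,T]}$ be probability density functions on $\mathbb T^d$ and $V_t:\mathbb T^d\to\mathbb R$ potentials such that the continuity equation $$\partial_t p_t(x)=-\nabla\cdot\big[p_t(x)\,\nabla V_t(x)\big]$$ holds for all $t\in[0,T]$ and $x\in\mathbb T^d$ (with one-sided time derivatives at $t=0$ and $t=T$). Let $N\ge 1$ be an integer power of $2$ and let $\mathbb X_N=\frac LN\{0,1,\dots,N-1\}$. For $x\in\mathbb X_N^d$ let $|x\rangle$ be the basis vector $|x_1N/L\rangle\otimes\cdots\otimes|x_dN/L\rangle$ of $(\mathbb C^{N})^{\otimes d}=\mathbb C^{N^d}$,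 and let $|\psi_t\rangle\propto\sum_{x\in\mathbb X_N^d}\sqrt{p_t(x)}\,|x\rangle$ be normalized to unit Euclidean norm. Let $$F=\frac1{\sqrt N}\sum_{j,\ell=0}^{N-1}e^{2\pi i j\ell/N}|j\rangle\langle \ell|,\quad S=\sum_{j=0}^{N-1}(-1)^j|j\rangle\langle j|,\quad D_K=\Big(\frac{2\pi}L\Big)^2\sum_{j=0}^{N-1}\Big(j-\frac N2\Big)^2|j\rangle\langle j|,$$ $$K=\tfrac12\big(SFD_KF^\dagger S^\dagger\big)^{\oplus d},\qquad D_{V_t}=\sum_{x\in\mathbb X_N^d}V_t(x)\,|x\rangle\langle x|,\qquad H_t^c=i[K,D_{V_t}],$$ where $M^{\oplus d}=M\otimes I\otimes\cdots\otimes I+\cdots+I\otimes\cdots\otimes I\otimes M$ is the $d$-fold Kronecker sum. Let $|\phi_t\rangle\in\mathbb C^{N^d}$ solve $i\frac{d}{dt}|\phi_t\rangle=H_t^c|\phi_t\rangle$ for $t\in[0,T]$, with an arbitrary initial vector $|\phi_0\rangle$. **Theorem.** Let $s\ge (d+7)/4$ be an integer. Suppose that $\sqrt{p_t},V_t\in\mathsf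 C^{2(s+1)}$ for every $t\in[0,T]$ and that, for every $x\in\mathbb T^d$, the quantities $V_t(x)$, $\nabla^2\sqrt{p_t(x)}$ and $\nabla^2[V_t(x)\sqrt{p_t(x)}]$ are continuous in $t\in[0,T]$. Define $$c_s=3\sup_{t\in[0,T]}\Big[\big(\|V_t\|_{\mathsf L^\infty}+1\big)\big\|\nabla^{2(s+1)}\sqrt{p_t}\big\|_{\mathsf L^2}+\big\|\nabla^{2(s+1)}(V_t\sqrt{p_t})\big\|_{\mathsf L^2}\Big]+1,$$ the supremum being assumed finite, and $$\delta=\big\||\psi_0\rangle-|\phi_0\rangle\big\|+T\,c_s\Big(\frac{Ld}{N}\Big)^{2s}.$$ If $\delta\le T$, then $\sum_{x\in\mathbb X_N^d}\sqrt{p_t(x)}\,|x\rangle\neq0$ for all $t\in[0,T]$ (so that $|\psi_t\rangle$ is a well-defined unit vector), and $$\big\||\psi_T\rangle-|\phi_T\rangle\big\|\le\delta .$$ -/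

import Mathlib

noncomputable section

namespace WavefunctionFlow

/-- Functions on the torus `𝕋^d` of edge length `L` are functions on `ℝ^d` that are `L`-periodic
in each coordinate. -/
def IsTorusPeriodic {d : ℕ} (L : ℝ) (f : EuclideanSpace ℝ (Fin d) → ℝ) : Prop :=
  ∀ (x : EuclideanSpace ℝ (Fin d)) (i : Fin d), f (x + EuclideanSpace.single i L) = f x

/-- The space `C^k(𝕋^d)` (real-valued functions). -/
def IsTorusCk {d : ℕ} (L : ℝ) (k : ℕ) (f : EuclideanSpace ℝ (Fin d) → ℝ) : Prop :=
  IsTorusPeriodic L f ∧ ContDiff ℝ k f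

/-- The fundamental domain `[0, L]^d` of the torus. -/
def cube (d : ℕ) (L : ℝ) : Set (EuclideanSpace ℝ (Fin d)) :=
  {x | ∀ i, x i ∈ Set.Icc 0 L}

/-- The norm of `L²(𝕋^d)`. -/
def torusL2Norm {d : ℕ} (L : ℝ) (f : EuclideanSpace ℝ (Fin d) → ℝ) : ℝ :=
  Real.sqrt (∫ x in cube d L, |f x| ^ 2)

/-- The norm of `L^∞(𝕋^d)` for a continuous function: the maximum of `|f|` over the torus. -/
def torusSupNorm {d : ℕ} (L : ℝ) (f : EuclideanSpace ℝ (Fin d) → ℝ) : ℝ :=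
  sSup ((fun x => |f x|) '' cube d L)

/-- The `m`-fold iterated Laplacian `∇^{2m} f`. -/
def iteratedLaplacian {d : ℕ} (m : ℕ) (f : EuclideanSpace ℝ (Fin d) → ℝ) :
    EuclideanSpace ℝ (Fin d) → ℝ :=
  (Laplacian.laplacian)^[m] f

/-- The divergence of a vector field on `ℝ^d`. -/
def divergence {d : ℕ} (v : EuclideanSpace ℝ (Fin d) → EuclideanSpace ℝ (Fin d))
    (x : EuclideanSpace ℝ (Fin d)) : ℝ :=
  ∑ i, fderiv ℝ (fun y => v y i) x (EuclideanSpace.single i 1)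

/-- `p` is a probability density function on the torus. -/
def IsTorusPDF {d : ℕ} (L : ℝ) (p : EuclideanSpace ℝ (Fin d) → ℝ) : Prop :=
  IsTorusPeriodic L p ∧ (∀ x, 0 ≤ p x) ∧ ∫ x in cube d L, p x = 1

/-- `p` obeys on `[0, T]` the continuity equation `∂ₜ pₜ = - ∇ · (pₜ ∇Vₜ)` with respect to the
conservative velocity field `∇Vₜ`. -/
def ContinuityEquation {d : ℕ} (T : ℝ) (p V : ℝ → EuclideanSpace ℝ (Fin d) → ℝ) : Prop :=
  ∀ t ∈ Set.Icc 0 T, ∀ x, HasDerivWithinAt (fun τ => p τ x)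
    (-divergence (fun y => p t y • gradient (V t) y) x) (Set.Icc 0 T) t

/-- The pointwise square root `√p`. -/
def sqrtFun {d : ℕ} (p : EuclideanSpace ℝ (Fin d) → ℝ) : EuclideanSpace ℝ (Fin d) → ℝ :=
  fun x => Real.sqrt (p x)

/-- The grid point `(L / N) j` for a tuple `j` in `{0, …, N-1}^d`. -/
def gridPoint {d N : ℕ} (L : ℝ) (j : Fin d → Fin N) : EuclideanSpace ℝ (Fin d) :=
  WithLp.toLp 2 (fun i => L / N * (j i : ℝ))

/-- The vector `∑ₓ f(x) |x⟩` of grid values. The basis vectors of `ℂ^{N^d} = (ℂ^N)^{⊗ d}` are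
indexed by tuples in `{0, …, N-1}^d`. -/
def gridVector {d : ℕ} (N : ℕ) (L : ℝ) (f : EuclideanSpace ℝ (Fin d) → ℝ) :
    EuclideanSpace ℂ (Fin d → Fin N) :=
  WithLp.toLp 2 (fun j => (f (gridPoint L j) : ℂ))

/-- The normalized grid qsample `∝ ∑ₓ √p(x) |x⟩`. -/
def qsample {d : ℕ} (N : ℕ) (L : ℝ) (p : EuclideanSpace ℝ (Fin d) → ℝ) :
    EuclideanSpace ℂ (Fin d → Fin N) :=
  ((‖gridVector N L (sqrtFun p)‖⁻¹ : ℝ) : ℂ) • gridVector N L (sqrtFun p)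

/-- The quantum Fourier transform matrix. -/
def matF (N : ℕ) : Matrix (Fin N) (Fin N) ℂ :=
  Matrix.of fun j l =>
    (1 / (Real.sqrt N : ℂ)) *
      Complex.exp (Complex.I * 2 * (Real.pi : ℂ) * ((j : ℕ) : ℂ) * ((l : ℕ) : ℂ) / (N : ℂ))

/-- The diagonal sign matrix. -/
def matS (N : ℕ) : Matrix (Fin N) (Fin N) ℂ :=
  Matrix.diagonal fun j => (-1 : ℂ) ^ (j : ℕ)

/-- The diagonal matrix of squared (shifted) wave numbers. -/
def matDK (N : ℕ) (L : ℝ) : Matrix (Fin N) (Fin N) ℂ :=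
  Matrix.diagonal fun j =>
    (((2 * Real.pi / L) ^ 2 * (((j : ℕ) : ℝ) - (N : ℝ) / 2) ^ 2 : ℝ) : ℂ)

/-- The tensor product `A₁ ⊗ ⋯ ⊗ A_d` of `N × N` matrices. -/
def tensorMatrix {d N : ℕ} (A : Fin d → Matrix (Fin N) (Fin N) ℂ) :
    Matrix (Fin d → Fin N) (Fin d → Fin N) ℂ :=
  Matrix.of fun j l => ∏ k, A k (j k) (l k)

/-- The `d`-fold Kronecker sum
`M ⊗ I ⊗ ⋯ ⊗ I + I ⊗ M ⊗ I ⊗ ⋯ ⊗ I + ⋯ + I ⊗ ⋯ ⊗ I ⊗ M`. -/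
def kroneckerSum {N : ℕ} (d : ℕ) (M : Matrix (Fin N) (Fin N) ℂ) :
    Matrix (Fin d → Fin N) (Fin d → Fin N) ℂ :=
  ∑ i : Fin d, tensorMatrix (Function.update (fun _ => 1) i M)

/-- The pseudo-spectral kinetic energy matrix `K = ½ (S F D_K F† S†)^{⊕ d}`. -/
def matK (d N : ℕ) (L : ℝ) : Matrix (Fin d → Fin N) (Fin d → Fin N) ℂ :=
  (1 / 2 : ℂ) • kroneckerSum d
    (matS N * matF N * matDK N L * (matF N).conjTranspose * (matS N).conjTranspose)

/-- The diagonal matrix `D_V` of the values of `V` on the grid. -/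
def matDV {d : ℕ} (N : ℕ) (L : ℝ) (V : EuclideanSpace ℝ (Fin d) → ℝ) :
    Matrix (Fin d → Fin N) (Fin d → Fin N) ℂ :=
  Matrix.diagonal fun j => (V (gridPoint L j) : ℂ)

/-- The discrete continuity Hamiltonian `i [K, D_V]`. -/
def discreteHamiltonian {d : ℕ} (N : ℕ) (L : ℝ) (V : EuclideanSpace ℝ (Fin d) → ℝ) :
    Matrix (Fin d → Fin N) (Fin d → Fin N) ℂ :=
  Complex.I • (matK d N L * matDV N L V - matDV N L V * matK d N L)

/-- `φ` solves on `[0, T]` the Schrödinger equation `i dφ/dt = H φ`, that is `dφ/dt = -i H φ`,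
with the Hamiltonian `H t`. -/
def SolvesSchrodinger {ι : Type*} [Fintype ι] [DecidableEq ι] (T : ℝ)
    (H : ℝ → Matrix ι ι ℂ) (φ : ℝ → EuclideanSpace ℂ ι) : Prop :=
  ∀ t ∈ Set.Icc 0 T,
    HasDerivWithinAt φ (-Complex.I • Matrix.toEuclideanLin (H t) (φ t)) (Set.Icc 0 T) t

/-- The quantity
`(‖Vₜ‖_∞ + 1) ‖∇^{2(s+1)} √pₜ‖₂ + ‖∇^{2(s+1)} (Vₜ √pₜ)‖₂` at one time. -/
def errorDensity {d : ℕ} (L : ℝ) (s : ℕ) (p V : EuclideanSpace ℝ (Fin d) → ℝ) : ℝ :=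
  (torusSupNorm L V + 1) * torusL2Norm L (iteratedLaplacian (s + 1) (sqrtFun p)) +
    torusL2Norm L (iteratedLaplacian (s + 1) (fun x => V x * sqrtFun p x))

/-- The constant `c_s`. -/
def errorConst {d : ℕ} (L T : ℝ) (s : ℕ) (p V : ℝ → EuclideanSpace ℝ (Fin d) → ℝ) : ℝ :=
  3 * sSup ((fun t => errorDensity L s (p t) (V t)) '' Set.Icc 0 T) + 1

end WavefunctionFlow

end

/-!
Writing `q = √p`, the continuity equation becomes `∂ₜ q = ½ (V ∇²q - ∇²(V q))`, i.e. `q` solves the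
Schrödinger equation of the Hamiltonian `i [-½∇², V]`; where `p` vanishes, `q` is minimal and both
sides are `0`. On the grid, `-½∇²` is replaced by `K`, which acts on each plane wave with the
eigenvalue of its alias in the Brillouin zone. By Parseval and Cauchy–Schwarz, the difference
between `∇²f` and `-2K f` on the grid is therefore at most `(L/N)^(2s) ‖∇^(2(s+1)) f‖₂` up to a
lattice sum `∑ |m|^(-4s)`, which converges as `d < 4s`. The same estimate bounds the norm of the
sampled `q` from below. Hence the sampled `q` solves the discrete equation up to a relative error of
at most `c_s (L/N)^(2s)`. Normalizing only projects this error, and since the discrete flow is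
unitary, the errors accumulate at most linearly in time.
-/

noncomputable section

namespace WavefunctionFlow

open MeasureTheory UnitAddTorus Filter InnerProductSpace
open scoped Topology Pointwise Matrix ComplexConjugate ComplexInnerProductSpace

variable {d : ℕ} {L : ℝ}

/-! ### Fourier series on the torus -/

/-- The Haar probability measure of the unit circle: the measure with respect to which
`UnitAddTorus.mFourierCoeff` is defined. -/
local instance haarUnitAddCircle : MeasureSpace UnitAddCircle := ⟨AddCircle.haarAddCircle⟩

local instance isAddHaarMeasure_unitAddCircle :
    Measure.IsAddHaarMeasure (volume : Measure UnitAddCircle) :=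
  inferInstanceAs (Measure.IsAddHaarMeasure AddCircle.haarAddCircle)

local instance isProbabilityMeasure_unitAddCircle :
    IsProbabilityMeasure (volume : Measure UnitAddCircle) :=
  inferInstanceAs (IsProbabilityMeasure AddCircle.haarAddCircle)

/-- The covering map from `ℝ^d` to the unit torus, with periods `L`. -/
def torusMk (L : ℝ) (x : EuclideanSpace ℝ (Fin d)) : UnitAddTorus (Fin d) :=
  fun i => ((x i / L : ℝ) : UnitAddCircle)

/-- The representative in `(0, L]^d` of a point of the unit torus. -/
def torusRep (L : ℝ) (θ : UnitAddTorus (Fin d)) : EuclideanSpace ℝ (Fin d) :=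
  WithLp.toLp 2 fun i => L * ((AddCircle.equivIoc 1 0 (θ i) : Set.Ioc (0 : ℝ) (0 + 1)) : ℝ)

theorem torusMk_torusRep (hL : 0 < L) (θ : UnitAddTorus (Fin d)) :
    torusMk L (torusRep L θ) = θ := by
  funext i
  simp only [torusMk, torusRep]
  rw [mul_div_cancel_left₀ _ hL.ne']
  exact (AddCircle.equivIoc 1 0).symm_apply_apply (θ i)

theorem isQuotientMap_torusMk (hL : 0 < L) : Topology.IsQuotientMap (torusMk (d := d) L) := by
  have hcircle : IsOpenQuotientMap (Pi.map fun (_ : Fin d) (y : ℝ) => (y : UnitAddCircle)) :=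
    IsOpenQuotientMap.piMap fun _ => QuotientAddGroup.isOpenQuotientMap_mk
  let rescale : EuclideanSpace ℝ (Fin d) ≃ₜ (Fin d → ℝ) :=
    (EuclideanSpace.equiv (Fin d) ℝ).toHomeomorph.trans
      (Homeomorph.piCongrRight fun _ => Homeomorph.mulRight₀ L⁻¹ (inv_ne_zero hL.ne'))
  exact hcircle.isQuotientMap.comp rescale.isQuotientMap

theorem IsTorusPeriodic.periodic_sum_zsmul {f : EuclideanSpace ℝ (Fin d) → ℝ}
    (hf : IsTorusPeriodic L f) (m : Fin d → ℤ) :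
    Function.Periodic f (∑ i, m i • EuclideanSpace.single i L) :=
  Finset.sum_induction _ (Function.Periodic f) (fun _ _ => Function.Periodic.add_period)
    (fun x => by rw [add_zero]) fun i _ => Function.Periodic.zsmul (hf · i) (m i)

theorem exists_eq_add_sum_zsmul_of_torusMk_eq (hL : 0 < L) {x y : EuclideanSpace ℝ (Fin d)}
    (h : torusMk L x = torusMk L y) :
    ∃ m : Fin d → ℤ, y = x + ∑ i, m i • EuclideanSpace.single i L := by
  have hcoord (i : Fin d) : ∃ m : ℤ, y i = x i + m * L := by
    obtain ⟨m, hm⟩ := QuotientAddGroup.eq_iff_sub_mem.1 (congrFun h i)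
    refine ⟨-m, ?_⟩
    simp only [zsmul_eq_mul, mul_one] at hm
    field_simp at hm
    push_cast
    linarith
  choose m hm using hcoord
  refine ⟨m, ?_⟩
  ext j
  simp [hm, Pi.single_apply]

theorem IsTorusPeriodic.eq_of_torusMk_eq {f : EuclideanSpace ℝ (Fin d) → ℝ} (hL : 0 < L)
    (hf : IsTorusPeriodic L f) {x y : EuclideanSpace ℝ (Fin d)} (h : torusMk L x = torusMk L y) :
    f x = f y := by
  obtain ⟨m, rfl⟩ := exists_eq_add_sum_zsmul_of_torusMk_eq hL h
  exact (hf.periodic_sum_zsmul m x).symm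

/-- A periodic function, as a complex function on the unit torus. -/
def torusLift (L : ℝ) (f : EuclideanSpace ℝ (Fin d) → ℝ) (θ : UnitAddTorus (Fin d)) : ℂ :=
  (f (torusRep L θ) : ℂ)

theorem torusLift_torusMk {f : EuclideanSpace ℝ (Fin d) → ℝ} (hL : 0 < L)
    (hf : IsTorusPeriodic L f) (x : EuclideanSpace ℝ (Fin d)) :
    torusLift L f (torusMk L x) = f x := by
  rw [torusLift, hf.eq_of_torusMk_eq hL (torusMk_torusRep hL (torusMk L x))]

theorem continuous_torusLift {f : EuclideanSpace ℝ (Fin d) → ℝ} (hL : 0 < L)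
    (hf : IsTorusPeriodic L f) (hc : Continuous f) : Continuous (torusLift L f) := by
  rw [(isQuotientMap_torusMk hL).continuous_iff]
  have hcomp : torusLift L f ∘ torusMk L = fun x => (f x : ℂ) :=
    funext fun x => torusLift_torusMk hL hf x
  rw [hcomp]
  fun_prop

theorem IsTorusPeriodic.exists_abs_le {f : EuclideanSpace ℝ (Fin d) → ℝ} (hL : 0 < L)
    (hf : IsTorusPeriodic L f) (hc : Continuous f) : ∃ C, ∀ x, |f x| ≤ C := by
  obtain ⟨C, hC⟩ := isCompact_univ.exists_bound_of_continuousOn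
    (continuous_torusLift hL hf hc).continuousOn
  refine ⟨C, fun x => ?_⟩
  have hx := hC (torusMk L x) trivial
  rwa [torusLift_torusMk hL hf, Complex.norm_real, Real.norm_eq_abs] at hx

/-- The Fourier coefficients of an `L`-periodic function, relative to the waves
`x ↦ exp (2πi k·x / L)`. -/
def torusFourierCoeff (L : ℝ) (f : EuclideanSpace ℝ (Fin d) → ℝ) (k : Fin d → ℤ) : ℂ :=
  mFourierCoeff (torusLift L f) k

theorem hasSum_torusFourierCoeff_mul {f : EuclideanSpace ℝ (Fin d) → ℝ} (hL : 0 < L)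
    (hf : IsTorusPeriodic L f) (hc : Continuous f) (h : Summable (torusFourierCoeff L f))
    (x : EuclideanSpace ℝ (Fin d)) :
    HasSum (fun k => torusFourierCoeff L f k * mFourier k (torusMk L x)) (f x) := by
  have hsum := hasSum_mFourier_series_apply_of_summable
    (f := ⟨torusLift L f, continuous_torusLift hL hf hc⟩) h (torusMk L x)
  simpa [torusLift_torusMk hL hf, torusFourierCoeff] using hsum

theorem smul_cube_one (hL : 0 < L) : L • cube d 1 = cube d L := by
  ext x
  rw [Set.mem_smul_set_iff_inv_smul_mem₀ hL.ne']
  refine forall_congr' fun i => ?_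
  simp only [PiLp.smul_apply, smul_eq_mul, Set.mem_Icc, inv_mul_le_iff₀ hL, mul_one,
    mul_nonneg_iff_of_pos_left (inv_pos.2 hL)]

theorem setIntegral_cube_one (g : EuclideanSpace ℝ (Fin d) → ℝ) :
    ∫ x in cube d 1, g x =
      ∫ x in {x : Fin d → ℝ | ∀ i, x i ∈ Set.Ioc (0 : ℝ) (0 + 1)}, g (WithLp.toLp 2 x) := by
  have hclosed : (WithLp.toLp 2) ⁻¹' cube d 1 = Set.Icc (0 : Fin d → ℝ) 1 := by
    ext x
    simp [cube, Pi.le_def, forall_and]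
  have hhalfOpen : {x : Fin d → ℝ | ∀ i, x i ∈ Set.Ioc (0 : ℝ) (0 + 1)} =
      Set.univ.pi fun _ => Set.Ioc (0 : ℝ) 1 := by
    ext
    simp
  have hae : (Set.univ.pi fun _ => Set.Ioc (0 : ℝ) 1) =ᵐ[(volume : Measure (Fin d → ℝ))]
      Set.Icc (0 : Fin d → ℝ) 1 := Measure.univ_pi_Ioc_ae_eq_Icc (f := 0) (g := 1)
  rw [hhalfOpen, setIntegral_congr_set hae, ← hclosed]
  exact ((PiLp.volume_preserving_toLp (Fin d)).setIntegral_preimage_emb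
    (MeasurableEquiv.toLp 2 (Fin d → ℝ)).measurableEmbedding g (cube d 1)).symm

theorem integral_unitAddTorus_eq (hL : 0 < L) (g : UnitAddTorus (Fin d) → ℝ) :
    ∫ θ, g θ = (L ^ d)⁻¹ * ∫ x in cube d L, g (torusMk L x) := by
  have hscale : ∫ x in cube d 1, g (torusMk L (L • x)) =
      (L ^ d)⁻¹ * ∫ x in cube d L, g (torusMk L x) := by
    rw [Measure.setIntegral_comp_smul_of_pos _ (fun x => g (torusMk L x)) _ hL, smul_cube_one hL]
    simp only [finrank_euclideanSpace, Fintype.card_fin, smul_eq_mul]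
  rw [← hscale, setIntegral_cube_one, UnitAddTorus.integral_preimage _ fun _ => (0 : ℝ)]
  refine integral_congr_ae (Eventually.of_forall fun x => congrArg g (funext fun i => ?_))
  simp [torusMk, mul_div_cancel_left₀ _ hL.ne']

theorem hasSum_sq_norm_torusFourierCoeff {f : EuclideanSpace ℝ (Fin d) → ℝ} (hL : 0 < L)
    (hf : IsTorusPeriodic L f) (hc : Continuous f) :
    HasSum (fun k => ‖torusFourierCoeff L f k‖ ^ 2) ((L ^ d)⁻¹ * torusL2Norm L f ^ 2) := by
  let F : C(UnitAddTorus (Fin d), ℂ) := ⟨torusLift L f, continuous_torusLift hL hf hc⟩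
  have hParseval := hasSum_sq_mFourierCoeff (ContinuousMap.toLp 2 volume ℂ F)
  simp only [mFourierCoeff_toLp] at hParseval
  have hnorm : ∫ θ, ‖ContinuousMap.toLp 2 volume ℂ F θ‖ ^ 2 =
      (L ^ d)⁻¹ * torusL2Norm L f ^ 2 := by
    calc ∫ θ, ‖ContinuousMap.toLp 2 volume ℂ F θ‖ ^ 2
        = ∫ θ, ‖F θ‖ ^ 2 := by
          refine integral_congr_ae ?_
          filter_upwards [ContinuousMap.coeFn_toLp volume F (p := 2) (𝕜 := ℂ)] with θ hθ
          rw [hθ]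
      _ = (L ^ d)⁻¹ * ∫ x in cube d L, |f x| ^ 2 := by
          simp only [integral_unitAddTorus_eq hL, F, ContinuousMap.coe_mk,
            torusLift_torusMk hL hf, Complex.norm_real, Real.norm_eq_abs]
      _ = (L ^ d)⁻¹ * torusL2Norm L f ^ 2 := by
          rw [torusL2Norm, Real.sq_sqrt (integral_nonneg fun x => by positivity)]
  exact hnorm ▸ hParseval

/-- The partial derivative in the `i`-th coordinate direction. -/
def pderiv (i : Fin d) (f : EuclideanSpace ℝ (Fin d) → ℝ) (x : EuclideanSpace ℝ (Fin d)) : ℝ :=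
  fderiv ℝ f x (EuclideanSpace.single i 1)

theorem IsTorusCk.of_le {f : EuclideanSpace ℝ (Fin d) → ℝ} {m n : ℕ} (hf : IsTorusCk L n f)
    (h : m ≤ n) : IsTorusCk L m f :=
  ⟨hf.1, hf.2.of_le (by exact_mod_cast h)⟩

theorem IsTorusPeriodic.pderiv {f : EuclideanSpace ℝ (Fin d) → ℝ} (hf : IsTorusPeriodic L f)
    (i : Fin d) : IsTorusPeriodic L (pderiv i f) := by
  intro x j
  have htranslate : (fun y => f (y + EuclideanSpace.single j L)) = f := funext fun y => hf y j
  unfold WavefunctionFlow.pderiv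
  rw [← fderiv_comp_add_right, htranslate]

theorem IsTorusCk.pderiv {f : EuclideanSpace ℝ (Fin d) → ℝ} {n : ℕ} (hf : IsTorusCk L (n + 1) f)
    (i : Fin d) : IsTorusCk L n (pderiv i f) :=
  ⟨hf.1.pderiv i, (hf.2.fderiv_right (m := n) (by norm_cast)).clm_apply contDiff_const⟩

theorem laplacian_eq_sum_pderiv {f : EuclideanSpace ℝ (Fin d) → ℝ} (hf : ContDiff ℝ 2 f) :
    Laplacian.laplacian f = fun x => ∑ i, pderiv i (pderiv i f) x := by
  funext x
  rw [laplacian_eq_iteratedFDeriv_orthonormalBasis f (EuclideanSpace.basisFun (Fin d) ℝ)]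
  refine Finset.sum_congr rfl fun i _ => ?_
  have hdiff : DifferentiableAt ℝ (fderiv ℝ f) x :=
    (hf.fderiv_right (m := 1) (by norm_num)).differentiable (by norm_num) x
  rw [iteratedFDeriv_two_apply]
  unfold pderiv
  rw [fderiv_clm_apply hdiff (differentiableAt_const _)]
  simp

theorem IsTorusCk.laplacian {f : EuclideanSpace ℝ (Fin d) → ℝ} {n : ℕ}
    (hf : IsTorusCk L (n + 2) f) : IsTorusCk L n (Laplacian.laplacian f) := by
  rw [laplacian_eq_sum_pderiv (hf.2.of_le (by exact_mod_cast Nat.le_add_left 2 n))]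
  have hpp (i : Fin d) : IsTorusCk L n (WavefunctionFlow.pderiv i (WavefunctionFlow.pderiv i f)) :=
    IsTorusCk.pderiv (IsTorusCk.pderiv hf i) i
  exact ⟨fun x j => Finset.sum_congr rfl fun i _ => (hpp i).1 x j,
    ContDiff.sum fun i _ => (hpp i).2⟩

theorem IsTorusCk.iteratedLaplacian {f : EuclideanSpace ℝ (Fin d) → ℝ} {n : ℕ} (m : ℕ)
    (hf : IsTorusCk L (n + 2 * m) f) : IsTorusCk L n (iteratedLaplacian m f) := by
  induction m generalizing f with
  | zero => exact hf
  | succ m ih => exact ih (IsTorusCk.laplacian (n := n + 2 * m) hf)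

theorem mFourier_torusMk (k : Fin d → ℤ) (x : EuclideanSpace ℝ (Fin d)) :
    mFourier k (torusMk L x) = ∏ i, Complex.exp (2 * Real.pi * Complex.I * k i * (x i / L)) := by
  simp only [mFourier, ContinuousMap.coe_mk, torusMk]
  refine Finset.prod_congr rfl fun i _ => ?_
  rw [fourier_coe_apply]
  congr 1
  push_cast
  ring

theorem mFourier_torusMk_smul_single (k : Fin d → ℤ) (i : Fin d) (h : ℝ) :
    mFourier k (torusMk L (h • EuclideanSpace.single i 1)) =
      Complex.exp (h * (2 * Real.pi * Complex.I * k i / L)) := by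
  rw [mFourier_torusMk, Finset.prod_eq_single i (fun j _ hj => by simp [hj]) (by simp)]
  congr 1
  simp only [PiLp.smul_apply, PiLp.single_apply, if_true, smul_eq_mul, mul_one]
  ring

theorem norm_mFourier_apply_le_one (k : Fin d → ℤ) (θ : UnitAddTorus (Fin d)) :
    ‖mFourier k θ‖ ≤ 1 :=
  (ContinuousMap.norm_coe_le_norm _ _).trans_eq mFourier_norm

theorem mFourier_apply_add (k : Fin d → ℤ) (θ η : UnitAddTorus (Fin d)) :
    mFourier k (θ + η) = mFourier k θ * mFourier k η := by
  simp only [mFourier, ContinuousMap.coe_mk, ← Finset.prod_mul_distrib, Pi.add_apply,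
    fourier_apply, smul_add, AddCircle.toCircle_add, Circle.coe_mul]

theorem torusMk_add (x y : EuclideanSpace ℝ (Fin d)) :
    torusMk L (x + y) = torusMk L x + torusMk L y := by
  funext i
  simp [torusMk, add_div]

theorem torusLift_add_torusMk {f : EuclideanSpace ℝ (Fin d) → ℝ} (hL : 0 < L)
    (hf : IsTorusPeriodic L f) (θ : UnitAddTorus (Fin d)) (v : EuclideanSpace ℝ (Fin d)) :
    torusLift L f (θ + torusMk L v) = f (torusRep L θ + v) := by
  conv_lhs => rw [← torusMk_torusRep hL θ, ← torusMk_add, torusLift_torusMk hL hf]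

theorem integral_mFourier_mul_torusLift_add (f : EuclideanSpace ℝ (Fin d) → ℝ) (k : Fin d → ℤ)
    (a : UnitAddTorus (Fin d)) :
    ∫ θ, mFourier (-k) θ * torusLift L f (θ + a) = mFourier k a * torusFourierCoeff L f k := by
  have hinv : mFourier k a * mFourier (-k) a = 1 := by
    rw [← mFourier_add, add_neg_cancel, mFourier_zero, ContinuousMap.one_apply]
  have hshift (θ : UnitAddTorus (Fin d)) : mFourier (-k) θ * torusLift L f (θ + a) =
      mFourier k a * (mFourier (-k) (θ + a) * torusLift L f (θ + a)) := by
    rw [mFourier_apply_add]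
    linear_combination (-(mFourier (-k) θ * torusLift L f (θ + a))) * hinv
  simp_rw [hshift]
  rw [integral_add_right_eq_self (μ := volume)
    (fun θ => mFourier k a * (mFourier (-k) θ * torusLift L f θ)) a, integral_const_mul]
  rfl

theorem hasDerivAt_torusLift_add_smul_single {f : EuclideanSpace ℝ (Fin d) → ℝ} (hL : 0 < L)
    (hf : IsTorusCk L 1 f) (i : Fin d) (θ : UnitAddTorus (Fin d)) (h : ℝ) :
    HasDerivAt (fun h : ℝ => torusLift L f (θ + torusMk L (h • EuclideanSpace.single i 1)))
      (torusLift L (pderiv i f) (θ + torusMk L (h • EuclideanSpace.single i 1))) h := by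
  simp only [torusLift_add_torusMk hL hf.1, torusLift_add_torusMk hL (hf.1.pderiv i)]
  have hline : HasDerivAt (fun h : ℝ => torusRep L θ + h • EuclideanSpace.single i 1)
      (EuclideanSpace.single i (1 : ℝ)) h := by
    simpa using ((hasDerivAt_id h).smul_const (EuclideanSpace.single i (1 : ℝ))).const_add
      (torusRep L θ)
  exact (((hf.2.differentiable one_ne_zero _).hasFDerivAt).comp_hasDerivAt h hline).ofReal_comp

theorem hasDerivAt_integral_mFourier_mul_torusLift_add {f : EuclideanSpace ℝ (Fin d) → ℝ}
    (hL : 0 < L) (hf : IsTorusCk L 1 f) (i : Fin d) (k : Fin d → ℤ) :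
    HasDerivAt (fun h : ℝ => ∫ θ, mFourier (-k) θ *
        torusLift L f (θ + torusMk L (h • EuclideanSpace.single i 1)))
      (∫ θ, mFourier (-k) θ *
        torusLift L (pderiv i f) (θ + torusMk L ((0 : ℝ) • EuclideanSpace.single i 1))) 0 := by
  have hf' : IsTorusCk L 0 (pderiv i f) := IsTorusCk.pderiv hf i
  obtain ⟨C, hC⟩ := hf'.1.exists_abs_le hL hf'.2.continuous
  have hcont {g : EuclideanSpace ℝ (Fin d) → ℝ} {n : ℕ} (hg : IsTorusCk L n g) (h : ℝ) :
      Continuous fun θ => mFourier (-k) θ *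
        torusLift L g (θ + torusMk L (h • EuclideanSpace.single i 1)) :=
    (mFourier (-k)).continuous.mul
      ((continuous_torusLift hL hg.1 hg.2.continuous).comp (continuous_add_const _))
  refine (hasDerivAt_integral_of_dominated_loc_of_deriv_le (bound := fun _ => C) univ_mem
    (Eventually.of_forall fun h => (hcont hf h).aestronglyMeasurable)
    ((hcont hf 0).integrable_of_hasCompactSupport (HasCompactSupport.of_compactSpace _))
    (hcont hf' 0).aestronglyMeasurable (Eventually.of_forall fun θ h _ => ?_)
    (integrable_const C)
    (Eventually.of_forall fun θ h _ =>
      (hasDerivAt_torusLift_add_smul_single hL hf i θ h).const_mul _)).2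
  rw [torusLift_add_torusMk hL hf'.1, norm_mul, Complex.norm_real]
  exact (mul_le_mul (norm_mFourier_apply_le_one _ _) (hC _) (abs_nonneg _) zero_le_one).trans_eq
    (one_mul C)

theorem torusFourierCoeff_pderiv {f : EuclideanSpace ℝ (Fin d) → ℝ} (hL : 0 < L)
    (hf : IsTorusCk L 1 f) (i : Fin d) (k : Fin d → ℤ) :
    torusFourierCoeff L (pderiv i f) k =
      2 * Real.pi * Complex.I * k i / L * torusFourierCoeff L f k := by
  have htranslate := hasDerivAt_integral_mFourier_mul_torusLift_add hL hf i k
  simp only [integral_mFourier_mul_torusLift_add, mFourier_torusMk_smul_single] at htranslate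
  have hexp : HasDerivAt
      (fun h : ℝ => Complex.exp (h * (2 * Real.pi * Complex.I * k i / L)) *
        torusFourierCoeff L f k)
      (2 * Real.pi * Complex.I * k i / L * torusFourierCoeff L f k) 0 := by
    simpa using (((Complex.ofRealCLM.hasDerivAt (x := (0 : ℝ))).mul_const
      (2 * Real.pi * Complex.I * k i / L)).cexp).mul_const (torusFourierCoeff L f k)
  simpa using htranslate.unique hexp

theorem torusFourierCoeff_sum {ι : Type*} (s : Finset ι) {f : ι → EuclideanSpace ℝ (Fin d) → ℝ}
    (hL : 0 < L) (hf : ∀ i, IsTorusPeriodic L (f i)) (hc : ∀ i, Continuous (f i))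
    (k : Fin d → ℤ) :
    torusFourierCoeff L (fun x => ∑ i ∈ s, f i x) k = ∑ i ∈ s, torusFourierCoeff L (f i) k := by
  simp only [torusFourierCoeff, mFourierCoeff, torusLift, Complex.ofReal_sum, Finset.smul_sum]
  exact integral_finsetSum _ fun i _ => Continuous.integrable_of_hasCompactSupport
    ((mFourier (-k)).continuous.smul (continuous_torusLift hL (hf i) (hc i)))
    (HasCompactSupport.of_compactSpace _)

/-- The squared Euclidean length of an integer vector. -/
def nsq (k : Fin d → ℤ) : ℝ := ∑ i, (k i : ℝ) ^ 2

theorem nsq_nonneg (k : Fin d → ℤ) : 0 ≤ nsq k :=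
  Finset.sum_nonneg fun _ _ => sq_nonneg _

/-- The eigenvalue `|2πk/L|²` of `-∇²` on the plane wave of wave vector `k`. -/
def laplacianSymbol (L : ℝ) (k : Fin d → ℤ) : ℝ := (2 * Real.pi / L) ^ 2 * nsq k

theorem laplacianSymbol_nonneg (L : ℝ) (k : Fin d → ℤ) : 0 ≤ laplacianSymbol L k :=
  mul_nonneg (sq_nonneg _) (nsq_nonneg k)

theorem torusFourierCoeff_laplacian {f : EuclideanSpace ℝ (Fin d) → ℝ} (hL : 0 < L)
    (hf : IsTorusCk L 2 f) (k : Fin d → ℤ) :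
    torusFourierCoeff L (Laplacian.laplacian f) k =
      -(laplacianSymbol L k : ℂ) * torusFourierCoeff L f k := by
  have hp (i : Fin d) : IsTorusCk L 1 (pderiv i f) := IsTorusCk.pderiv hf i
  have hpp (i : Fin d) : IsTorusCk L 0 (pderiv i (pderiv i f)) := IsTorusCk.pderiv (hp i) i
  rw [laplacian_eq_sum_pderiv hf.2, torusFourierCoeff_sum _ hL (fun i => (hpp i).1)
    fun i => (hpp i).2.continuous]
  simp only [torusFourierCoeff_pderiv hL (hp _), torusFourierCoeff_pderiv hL (hf.of_le one_le_two),
    laplacianSymbol, nsq]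
  push_cast
  rw [Finset.mul_sum, ← Finset.sum_neg_distrib, Finset.sum_mul]
  refine Finset.sum_congr rfl fun i _ => ?_
  linear_combination
    (4 * Real.pi ^ 2 * (k i) ^ 2 / L ^ 2 * torusFourierCoeff L f k : ℂ) * Complex.I_sq

theorem norm_torusFourierCoeff_laplacian {f : EuclideanSpace ℝ (Fin d) → ℝ} (hL : 0 < L)
    (hf : IsTorusCk L 2 f) (k : Fin d → ℤ) :
    ‖torusFourierCoeff L (Laplacian.laplacian f) k‖ =
      laplacianSymbol L k * ‖torusFourierCoeff L f k‖ := by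
  rw [torusFourierCoeff_laplacian hL hf, norm_mul, norm_neg, Complex.norm_real,
    Real.norm_of_nonneg (laplacianSymbol_nonneg L k)]

theorem norm_torusFourierCoeff_iteratedLaplacian {f : EuclideanSpace ℝ (Fin d) → ℝ} (hL : 0 < L)
    (m : ℕ) (hf : IsTorusCk L (2 * m) f) (k : Fin d → ℤ) :
    ‖torusFourierCoeff L (iteratedLaplacian m f) k‖ =
      laplacianSymbol L k ^ m * ‖torusFourierCoeff L f k‖ := by
  induction m generalizing f with
  | zero => simp [iteratedLaplacian]
  | succ m ih =>
    have hsucc : iteratedLaplacian (m + 1) f = iteratedLaplacian m (Laplacian.laplacian f) :=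
      Function.iterate_succ_apply _ _ _
    rw [hsucc, ih (IsTorusCk.laplacian (n := 2 * m) hf),
      norm_torusFourierCoeff_laplacian hL (hf.of_le (by omega)), pow_succ, mul_assoc]

/-! ### Plane waves on the grid and the discrete kinetic operator -/

variable {N : ℕ}

theorem exp_two_pi_I_mul_div_eq_one_iff [NeZero N] (k : ℤ) :
    Complex.exp (2 * Real.pi * Complex.I * k / N) = 1 ↔ (N : ℤ) ∣ k := by
  rw [← (Complex.isPrimitiveRoot_exp N (NeZero.ne N)).zpow_eq_one_iff_dvd, ← Complex.exp_int_mul,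
    mul_div_assoc', mul_comm]

/-- The one-dimensional plane wave of wave number `k` on the grid `{0, …, N-1}`. -/
def wave (N : ℕ) (k : ℤ) (j : Fin N) : ℂ :=
  Complex.exp (2 * Real.pi * Complex.I * k * ((j : ℕ) / N))

theorem wave_eq_pow (k : ℤ) (j : Fin N) :
    wave N k j = Complex.exp (2 * Real.pi * Complex.I * k / N) ^ (j : ℕ) := by
  rw [wave, ← Complex.exp_nat_mul]
  congr 1
  ring

theorem wave_add (k l : ℤ) (j : Fin N) : wave N (k + l) j = wave N k j * wave N l j := by
  rw [wave, wave, wave, ← Complex.exp_add]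
  congr 1
  push_cast
  ring

theorem conj_wave (k : ℤ) (j : Fin N) : conj (wave N k j) = wave N (-k) j := by
  rw [wave, wave, ← Complex.exp_conj]
  congr 1
  simp only [map_mul, map_div₀, Complex.conj_ofReal, Complex.conj_I, Complex.conj_natCast,
    map_ofNat, map_intCast, Int.cast_neg]
  ring

theorem wave_of_dvd [NeZero N] {k : ℤ} (hk : (N : ℤ) ∣ k) (j : Fin N) : wave N k j = 1 := by
  rw [wave_eq_pow, (exp_two_pi_I_mul_div_eq_one_iff k).2 hk, one_pow]

theorem sum_wave [NeZero N] (k : ℤ) :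
    ∑ j : Fin N, wave N k j = if (N : ℤ) ∣ k then (N : ℂ) else 0 := by
  split_ifs with hk
  · simp [wave_of_dvd hk]
  · have hne := (exp_two_pi_I_mul_div_eq_one_iff (N := N) k).not.2 hk
    have hpow : Complex.exp (2 * Real.pi * Complex.I * k / N) ^ N = 1 := by
      rw [← Complex.exp_nat_mul, mul_div_cancel₀ _ (NeZero.ne (N : ℂ))]
      exact Complex.exp_eq_one_iff.2 ⟨k, by ring⟩
    simp_rw [wave_eq_pow]
    rw [Fin.sum_univ_eq_sum_range (fun j => Complex.exp (2 * Real.pi * Complex.I * k / N) ^ j),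
      geom_sum_eq hne, hpow, sub_self, zero_div]

theorem natCast_dvd_sub_iff_eq (a b : Fin N) : (N : ℤ) ∣ (a : ℕ) - (b : ℕ) ↔ a = b := by
  refine ⟨fun h => Fin.ext ?_, fun h => by simp [h]⟩
  have habs : |((a : ℕ) - (b : ℕ) : ℤ)| < N := abs_lt.2 (by omega)
  have := Int.eq_zero_of_abs_lt_dvd h habs
  omega

/-- The plane wave of wave vector `k` on the grid. -/
def gridMode (N : ℕ) (k : Fin d → ℤ) : EuclideanSpace ℂ (Fin d → Fin N) :=
  WithLp.toLp 2 fun j => ∏ i, wave N (k i) (j i)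

theorem inner_gridMode [NeZero N] (k l : Fin d → ℤ) :
    ⟪gridMode N k, gridMode N l⟫ = if ∀ i, (N : ℤ) ∣ l i - k i then (N : ℂ) ^ d else 0 := by
  have hprod : ⟪gridMode N k, gridMode N l⟫ = ∏ i, ∑ j : Fin N, wave N (l i - k i) j := by
    rw [Finset.prod_univ_sum, PiLp.inner_apply, Fintype.piFinset_univ]
    refine Finset.sum_congr rfl fun j _ => ?_
    simp only [gridMode, RCLike.inner_apply, map_prod, conj_wave, ← Finset.prod_mul_distrib,
      ← wave_add, sub_eq_add_neg]
  rw [hprod]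
  simp_rw [sum_wave]
  split_ifs with h
  · simp [h]
  · push Not at h
    obtain ⟨i, hi⟩ := h
    exact Finset.prod_eq_zero (Finset.mem_univ i) (if_neg hi)

/-- Every wave vector is, uniquely, a representative in the Brillouin zone
`{-N/2, …, N - N/2 - 1}^d`, indexed from `0`, plus `N` times an alias shift. -/
def aliasEquiv (d N : ℕ) [NeZero N] : (Fin d → Fin N) × (Fin d → ℤ) ≃ (Fin d → ℤ) :=
  (Equiv.arrowProdEquivProdArrow _ _ _).symm.trans <| Equiv.piCongrRight fun _ =>
    (Equiv.prodComm _ _).trans ((Int.divModEquiv N).symm.trans (Equiv.subRight ((N / 2 : ℕ) : ℤ)))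

theorem aliasEquiv_apply [NeZero N] (q : (Fin d → Fin N) × (Fin d → ℤ)) (i : Fin d) :
    aliasEquiv d N q i = (q.1 i : ℕ) - (N / 2 : ℕ) + N * q.2 i := by
  simp [aliasEquiv, Int.divModEquiv]
  ring

theorem gridMode_aliasEquiv [NeZero N] (κ : Fin d → Fin N) (m : Fin d → ℤ) :
    gridMode N (aliasEquiv d N (κ, m)) = gridMode N (aliasEquiv d N (κ, 0)) := by
  ext j
  simp [gridMode, aliasEquiv_apply, wave_add, wave_of_dvd]

theorem inner_gridMode_aliasEquiv [NeZero N] (κ κ' : Fin d → Fin N) :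
    ⟪gridMode N (aliasEquiv d N (κ, 0)), gridMode N (aliasEquiv d N (κ', 0))⟫ =
      if κ = κ' then (N : ℂ) ^ d else 0 := by
  simp only [inner_gridMode, aliasEquiv_apply, Pi.zero_apply, mul_zero, add_zero,
    sub_sub_sub_cancel_right, natCast_dvd_sub_iff_eq, funext_iff, eq_comm]

theorem norm_sq_sum_smul_gridMode [NeZero N] (c : EuclideanSpace ℂ (Fin d → Fin N)) :
    ‖∑ κ, c κ • gridMode N (aliasEquiv d N (κ, 0))‖ ^ 2 = (N : ℝ) ^ d * ‖c‖ ^ 2 := by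
  apply Complex.ofReal_injective
  rw [Complex.ofReal_pow, ← Complex.coe_algebraMap, ← inner_self_eq_norm_sq_to_K]
  simp only [sum_inner, inner_sum, inner_smul_left, inner_smul_right, inner_gridMode_aliasEquiv,
    mul_ite, mul_zero, Finset.sum_ite_eq', Finset.mem_univ, if_true]
  rw [EuclideanSpace.norm_sq_eq]
  push_cast
  rw [Finset.mul_sum]
  refine Finset.sum_congr rfl fun κ _ => ?_
  linear_combination (N : ℂ) ^ d * Complex.conj_mul' (c κ)

theorem matS_mul_matF_apply (hN : Even N) (j l : Fin N) :
    (matS N * matF N) j l = (Real.sqrt N : ℂ)⁻¹ * wave N ((l : ℕ) - (N / 2 : ℕ)) j := by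
  obtain ⟨M, rfl⟩ := hN.two_dvd
  have hM : (M : ℂ) ≠ 0 := Nat.cast_ne_zero.2 (by have := j.pos; omega)
  have hsign : (-1 : ℂ) ^ (j : ℕ) = Complex.exp (-(Real.pi * Complex.I) * (j : ℕ)) := by
    rw [mul_comm (-(Real.pi * Complex.I)), Complex.exp_nat_mul, Complex.exp_neg,
      Complex.exp_pi_mul_I, inv_neg_one]
  rw [matS, Matrix.diagonal_mul, matF, Matrix.of_apply, wave, hsign, mul_left_comm,
    ← Complex.exp_add, one_div, Nat.mul_div_cancel_left M two_pos]
  congr 2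
  push_cast
  field_simp
  ring

theorem conjTranspose_matS_mul_matF_mul_self (hN : Even N) :
    (matS N * matF N)ᴴ * (matS N * matF N) = 1 := by
  ext l l'
  have : NeZero N := ⟨l.pos.ne'⟩
  have hsqrt : (Real.sqrt N : ℂ)⁻¹ * (Real.sqrt N : ℂ)⁻¹ = (N : ℂ)⁻¹ := by
    rw [← mul_inv, ← Complex.ofReal_mul, Real.mul_self_sqrt (Nat.cast_nonneg N),
      Complex.ofReal_natCast]
  have hterm (j : Fin N) : (matS N * matF N)ᴴ l j * (matS N * matF N) j l' =
      (N : ℂ)⁻¹ * wave N ((l' : ℕ) - (l : ℕ)) j := by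
    rw [Matrix.conjTranspose_apply, matS_mul_matF_apply hN, matS_mul_matF_apply hN,
      RCLike.star_def, map_mul, map_inv₀, Complex.conj_ofReal, conj_wave, mul_mul_mul_comm, hsqrt,
      ← wave_add]
    ring_nf
  rw [Matrix.mul_apply, Finset.sum_congr rfl fun j _ => hterm j, ← Finset.mul_sum, sum_wave,
    Matrix.one_apply]
  simp [natCast_dvd_sub_iff_eq, eq_comm]

/-- The one-dimensional kinetic matrix `S F D_K F† S†`. -/
def kineticMatrix (N : ℕ) (L : ℝ) : Matrix (Fin N) (Fin N) ℂ :=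
  matS N * matF N * matDK N L * (matF N)ᴴ * (matS N)ᴴ

theorem kineticMatrix_eq (N : ℕ) (L : ℝ) : kineticMatrix N L =
    (matS N * matF N) * matDK N L * (matS N * matF N)ᴴ := by
  simp only [kineticMatrix, Matrix.conjTranspose_mul, Matrix.mul_assoc]

theorem isHermitian_kineticMatrix (N : ℕ) (L : ℝ) : (kineticMatrix N L).IsHermitian := by
  rw [kineticMatrix_eq]
  refine Matrix.isHermitian_mul_mul_conjTranspose _
    (Matrix.isHermitian_diagonal_of_self_adjoint _ ?_)
  funext j
  simp [Complex.conj_ofReal]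

theorem kineticMatrix_mulVec_wave (hN : Even N) (κ : Fin N) :
    kineticMatrix N L *ᵥ wave N ((κ : ℕ) - (N / 2 : ℕ)) =
      (((2 * Real.pi / L) ^ 2 * (((κ : ℕ) : ℝ) - (N : ℝ) / 2) ^ 2 : ℝ) : ℂ) •
        wave N ((κ : ℕ) - (N / 2 : ℕ)) := by
  have : NeZero N := ⟨κ.pos.ne'⟩
  have hsqrt : (Real.sqrt N : ℂ) ≠ 0 :=
    Complex.ofReal_ne_zero.2 (Real.sqrt_ne_zero'.2 (by exact_mod_cast κ.pos))
  have hwave : wave N ((κ : ℕ) - (N / 2 : ℕ)) =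
      (matS N * matF N) *ᵥ Pi.single κ (Real.sqrt N : ℂ) := by
    funext j
    rw [Matrix.mulVec_single, Pi.smul_apply, Matrix.col_apply, matS_mul_matF_apply hN,
      MulOpposite.smul_eq_mul_unop, MulOpposite.unop_op]
    field_simp
  rw [kineticMatrix_eq, hwave, ← Matrix.mulVec_mulVec, Matrix.mulVec_mulVec _ _ᴴ,
    conjTranspose_matS_mul_matF_mul_self hN, Matrix.one_mulVec, ← Matrix.mulVec_mulVec, matDK,
    Matrix.diagonal_mulVec_single, ← Matrix.mulVec_smul, ← Pi.single_smul, smul_eq_mul]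

theorem tensorMatrix_mulVec_prod (A : Fin d → Matrix (Fin N) (Fin N) ℂ)
    (v : Fin d → Fin N → ℂ) :
    tensorMatrix A *ᵥ (fun j => ∏ k, v k (j k)) = fun j => ∏ k, (A k *ᵥ v k) (j k) := by
  funext j
  simp only [Matrix.mulVec, dotProduct, tensorMatrix, Matrix.of_apply, ← Finset.prod_mul_distrib]
  rw [Finset.prod_univ_sum, Fintype.piFinset_univ]

theorem isHermitian_tensorMatrix {A : Fin d → Matrix (Fin N) (Fin N) ℂ}
    (hA : ∀ k, (A k).IsHermitian) : (tensorMatrix A).IsHermitian := by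
  ext j l
  simp only [Matrix.conjTranspose_apply, tensorMatrix, Matrix.of_apply, star_prod]
  exact Finset.prod_congr rfl fun k _ => (hA k).apply _ _

theorem kroneckerSum_mulVec_prod {M : Matrix (Fin N) (Fin N) ℂ} {v : Fin d → Fin N → ℂ}
    {μ : Fin d → ℂ} (h : ∀ i, M *ᵥ v i = μ i • v i) :
    kroneckerSum d M *ᵥ (fun j => ∏ k, v k (j k)) = (∑ i, μ i) • fun j => ∏ k, v k (j k) := by
  rw [kroneckerSum, Matrix.sum_mulVec, Finset.sum_smul]
  refine Finset.sum_congr rfl fun i _ => ?_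
  rw [tensorMatrix_mulVec_prod]
  funext j
  rw [Pi.smul_apply, ← Finset.mul_prod_erase _ _ (Finset.mem_univ i),
    ← Finset.mul_prod_erase _ _ (Finset.mem_univ i), Function.update_self, h, Pi.smul_apply,
    smul_eq_mul, smul_eq_mul, mul_assoc]
  congr 2
  refine Finset.prod_congr rfl fun k hk => ?_
  rw [Function.update_of_ne (Finset.ne_of_mem_erase hk), Matrix.one_mulVec]

theorem isHermitian_kroneckerSum (d : ℕ) {M : Matrix (Fin N) (Fin N) ℂ} (hM : M.IsHermitian) :
    (kroneckerSum d M).IsHermitian := by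
  rw [kroneckerSum, Matrix.IsHermitian, Matrix.conjTranspose_sum]
  refine Finset.sum_congr rfl fun i _ => isHermitian_tensorMatrix fun k => ?_
  rcases eq_or_ne k i with rfl | hk
  · rwa [Function.update_self]
  · rw [Function.update_of_ne hk]
    exact Matrix.isHermitian_one

theorem matK_eq (d N : ℕ) (L : ℝ) :
    matK d N L = (1 / 2 : ℂ) • kroneckerSum d (kineticMatrix N L) := rfl

theorem isHermitian_matK (d N : ℕ) (L : ℝ) : (matK d N L).IsHermitian := by
  rw [matK_eq, Matrix.IsHermitian, Matrix.conjTranspose_smul,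
    isHermitian_kroneckerSum d (isHermitian_kineticMatrix N L)]
  simp

theorem toEuclideanLin_matK_gridMode [NeZero N] (hN : Even N)
    (q : (Fin d → Fin N) × (Fin d → ℤ)) :
    (matK d N L).toEuclideanLin (gridMode N (aliasEquiv d N q)) =
      ((laplacianSymbol L (aliasEquiv d N (q.1, 0)) / 2 : ℝ) : ℂ) •
        gridMode N (aliasEquiv d N q) := by
  rw [← Prod.mk.eta (p := q), gridMode_aliasEquiv]
  have hcenter : ((N / 2 : ℕ) : ℝ) = N / 2 := by
    rw [Nat.cast_div_charZero hN.two_dvd, Nat.cast_two]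
  have heigen := kroneckerSum_mulVec_prod (M := kineticMatrix N L)
    (v := fun i => wave N (aliasEquiv d N (q.1, 0) i))
    (μ := fun i => (((2 * Real.pi / L) ^ 2 * (((q.1 i : ℕ) : ℝ) - (N : ℝ) / 2) ^ 2 : ℝ) : ℂ))
    fun i => by simpa [aliasEquiv_apply] using kineticMatrix_mulVec_wave (L := L) hN (q.1 i)
  have hfreq : 1 / 2 * ∑ i, (2 * Real.pi / L) ^ 2 * (((q.1 i : ℕ) : ℝ) - (N : ℝ) / 2) ^ 2 =
      laplacianSymbol L (aliasEquiv d N (q.1, 0)) / 2 := by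
    simp only [laplacianSymbol, nsq, aliasEquiv_apply, Pi.zero_apply, mul_zero, add_zero,
      Int.cast_sub, Int.cast_natCast, hcenter, ← Finset.mul_sum]
    ring
  apply (WithLp.equiv 2 _).injective
  change matK d N L *ᵥ (fun j : Fin d → Fin N => ∏ i, wave N (aliasEquiv d N (q.1, 0) i) (j i)) =
    (_ : ℂ) • fun j : Fin d → Fin N => ∏ i, wave N (aliasEquiv d N (q.1, 0) i) (j i)
  rw [matK_eq, Matrix.smul_mulVec, heigen, smul_smul, ← hfreq]
  push_cast
  rfl

/-! ### Lattice sums -/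

theorem sq_le_nsq_of_notMem_Icc {n : ℕ} {m : Fin d → ℤ} (hm : m ∉ Finset.Icc (-n : Fin d → ℤ) n) :
    ((n : ℝ) + 1) ^ 2 ≤ nsq m := by
  obtain ⟨i, hi⟩ : ∃ i, (n : ℤ) < |m i| := by
    contrapose! hm
    exact Finset.mem_Icc.2 ⟨fun i => (abs_le.1 (hm i)).1, fun i => (abs_le.1 (hm i)).2⟩
  calc ((n : ℝ) + 1) ^ 2 ≤ |(m i : ℝ)| ^ 2 := by
        gcongr
        exact_mod_cast Int.add_one_le_iff.2 hi
    _ = (m i : ℝ) ^ 2 := sq_abs _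
    _ ≤ nsq m := Finset.single_le_sum (f := fun i => (m i : ℝ) ^ 2)
        (fun _ _ => sq_nonneg _) (Finset.mem_univ i)

theorem one_le_nsq {m : Fin d → ℤ} (hm : m ≠ 0) : 1 ≤ nsq m := by
  simpa using sq_le_nsq_of_notMem_Icc (n := 0) (m := m) (by simpa using hm)

/-- The weight `|m|^{-2s}` of a lattice point `m`. The point `0`, where the inverse takes the junk
value `0`, has weight `0` if `s ≠ 0`. -/
def latticeWeight (s : ℕ) (m : Fin d → ℤ) : ℝ := ((nsq m)⁻¹) ^ s

theorem latticeWeight_nonneg (s : ℕ) (m : Fin d → ℤ) : 0 ≤ latticeWeight s m :=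
  pow_nonneg (inv_nonneg.2 (nsq_nonneg m)) s

theorem latticeWeight_zero {s : ℕ} (hs : s ≠ 0) : latticeWeight s (0 : Fin d → ℤ) = 0 := by
  simp [latticeWeight, nsq, hs]

theorem card_Icc_neg_natCast (n : ℕ) :
    (Finset.Icc (-n : Fin d → ℤ) n).card = (2 * n + 1) ^ d := by
  simp only [Pi.card_Icc, Pi.neg_apply, Pi.natCast_apply, Int.card_Icc, Finset.prod_const,
    Finset.card_univ, Fintype.card_fin]
  congr 1
  omega

theorem card_box_succ_le (n : ℕ) :
    ((Finset.box (n + 1) : Finset (Fin d → ℤ)).card : ℝ) ≤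
      2 * d * 3 ^ (d - 1) * (n + 1) ^ (d - 1) := by
  have hcard : ((Finset.box (n + 1) : Finset (Fin d → ℤ)).card : ℝ) =
      (2 * ((n : ℝ) + 1) + 1) ^ d - (2 * n + 1) ^ d := by
    have := congrArg Finset.card (Finset.box_succ_disjUnion (α := Fin d → ℤ) n)
    rw [Finset.card_disjUnion, card_Icc_neg_natCast, card_Icc_neg_natCast] at this
    rw [eq_sub_iff_add_eq]
    exact_mod_cast this
  have hpow := abs_pow_sub_pow_le (2 * ((n : ℝ) + 1) + 1) (2 * n + 1) d
  have hn : (0 : ℝ) ≤ n := n.cast_nonneg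
  rw [abs_of_nonneg (by positivity : 0 ≤ 2 * ((n : ℝ) + 1) + 1),
    abs_of_nonneg (by positivity : 0 ≤ 2 * (n : ℝ) + 1), max_eq_left (by linarith),
    show 2 * ((n : ℝ) + 1) + 1 - (2 * n + 1) = 2 by ring, abs_two] at hpow
  rw [hcard, mul_assoc, ← mul_pow]
  refine (le_abs_self _).trans (hpow.trans ?_)
  gcongr
  linarith

theorem sum_sq_latticeWeight_box_succ_le {s : ℕ} (hs : d < 4 * s) (n : ℕ) :
    ∑ m ∈ (Finset.box (n + 1) : Finset (Fin d → ℤ)), latticeWeight s m ^ 2 ≤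
      2 * d * 3 ^ (d - 1) * (1 / ((n : ℝ) + 1) ^ 2) := by
  have hweight : ∀ m ∈ (Finset.box (n + 1) : Finset (Fin d → ℤ)),
      latticeWeight s m ^ 2 ≤ (((n : ℝ) + 1) ^ (d + 1))⁻¹ := by
    intro m hm
    rw [Finset.box_succ_eq_sdiff] at hm
    have hinv : (nsq m)⁻¹ ≤ (((n : ℝ) + 1) ^ 2)⁻¹ :=
      inv_anti₀ (by positivity) (sq_le_nsq_of_notMem_Icc (Finset.mem_sdiff.1 hm).2)
    calc latticeWeight s m ^ 2 ≤ (((((n : ℝ) + 1) ^ 2)⁻¹) ^ s) ^ 2 :=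
          pow_le_pow_left₀ (latticeWeight_nonneg s m)
            (pow_le_pow_left₀ (inv_nonneg.2 (nsq_nonneg m)) hinv s) 2
      _ = (((n : ℝ) + 1) ^ (4 * s))⁻¹ := by rw [inv_pow, inv_pow, ← pow_mul, ← pow_mul]; ring_nf
      _ ≤ (((n : ℝ) + 1) ^ (d + 1))⁻¹ := by
          gcongr
          · linarith [n.cast_nonneg (α := ℝ)]
          · exact hs
  refine (Finset.sum_le_card_nsmul _ _ _ hweight).trans ?_
  rw [nsmul_eq_mul]
  refine (mul_le_mul_of_nonneg_right (card_box_succ_le n) (by positivity)).trans_eq ?_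
  rcases d with _ | d
  · simp
  · rw [Nat.add_sub_cancel]
    field_simp
    ring

theorem sum_sq_latticeWeight_Icc_le {s : ℕ} (hs : d < 4 * s) (n : ℕ) :
    ∑ m ∈ Finset.Icc (-n : Fin d → ℤ) n, latticeWeight s m ^ 2 ≤
      2 * d * 3 ^ (d - 1) * ∑ k ∈ Finset.range n, 1 / ((k : ℝ) + 1) ^ 2 := by
  induction n with
  | zero => simp [latticeWeight_zero (d := d) (show s ≠ 0 by omega)]
  | succ n ih =>
    rw [← Finset.box_succ_disjUnion, Finset.sum_disjUnion, Finset.sum_range_succ, mul_add,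
      add_comm]
    exact add_le_add ih (sum_sq_latticeWeight_box_succ_le hs n)

theorem sum_range_one_div_sq_le (n : ℕ) :
    ∑ k ∈ Finset.range n, 1 / ((k : ℝ) + 1) ^ 2 ≤ Real.pi ^ 2 / 6 := by
  have hzeta := (hasSum_nat_add_iff' 1).2 hasSum_zeta_two
  simp only [Finset.range_one, Finset.sum_singleton, Nat.cast_zero, ne_eq, OfNat.ofNat_ne_zero,
    not_false_eq_true, zero_pow, div_zero, sub_zero, Nat.cast_add, Nat.cast_one] at hzeta
  exact sum_le_hasSum _ (fun _ _ => by positivity) hzeta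

theorem sum_sq_latticeWeight_le {s : ℕ} (hs : d < 4 * s) (S : Finset (Fin d → ℤ)) :
    ∑ m ∈ S, latticeWeight s m ^ 2 ≤ 2 * d * 3 ^ (d - 1) * (Real.pi ^ 2 / 6) := by
  obtain ⟨n, hn⟩ : ∃ n : ℕ, S ⊆ Finset.Icc (-n : Fin d → ℤ) n := by
    refine ⟨∑ m ∈ S, ∑ i, (m i).natAbs, fun m hm => Finset.mem_Icc.2 ?_⟩
    have hle (i : Fin d) : (m i).natAbs ≤ ∑ m ∈ S, ∑ i, (m i).natAbs :=
      (Finset.single_le_sum (f := fun i => (m i).natAbs) (by simp) (Finset.mem_univ i)).trans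
        (Finset.single_le_sum (f := fun m : Fin d → ℤ => ∑ i, (m i).natAbs) (by simp) hm)
    constructor <;> intro i <;> simp only [Pi.neg_apply, Pi.natCast_apply] <;>
      have := hle i <;> omega
  calc ∑ m ∈ S, latticeWeight s m ^ 2
      ≤ ∑ m ∈ Finset.Icc (-n : Fin d → ℤ) n, latticeWeight s m ^ 2 :=
        Finset.sum_le_sum_of_subset_of_nonneg hn fun _ _ _ => sq_nonneg _
    _ ≤ _ := (sum_sq_latticeWeight_Icc_le hs n).trans
        (mul_le_mul_of_nonneg_left (sum_range_one_div_sq_le n) (by positivity))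

theorem summable_sq_latticeWeight {s : ℕ} (hs : d < 4 * s) :
    Summable fun m : Fin d → ℤ => latticeWeight s m ^ 2 :=
  summable_of_sum_le (fun _ => sq_nonneg _) (sum_sq_latticeWeight_le hs)

theorem natCast_mul_three_pow_le (d : ℕ) : d * 3 ^ (d - 1) ≤ 27 * Real.pi ^ (d - 1) := by
  have hbern := one_add_mul_le_pow (a := Real.pi / 3 - 1) (by linarith [Real.pi_pos]) (d - 1)
  have hd : (d : ℝ) ≤ (d - 1 : ℕ) + 1 := by exact_mod_cast (by omega : d ≤ d - 1 + 1)
  have hle : (d : ℝ) ≤ 27 * (Real.pi / 3) ^ (d - 1) := by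
    have := mul_le_mul_of_nonneg_left
      (show 1 / 27 ≤ Real.pi / 3 - 1 by linarith [Real.pi_gt_d2]) (d - 1 : ℕ).cast_nonneg
    rw [add_sub_cancel] at hbern
    linarith
  calc (d : ℝ) * 3 ^ (d - 1) ≤ 27 * (Real.pi / 3) ^ (d - 1) * 3 ^ (d - 1) := by gcongr
    _ = 27 * Real.pi ^ (d - 1) := by rw [mul_assoc, ← mul_pow, div_mul_cancel₀ _ three_ne_zero]

theorem tsum_sq_latticeWeight_le {s : ℕ} (hs : d < 4 * s) :
    ∑' m : Fin d → ℤ, latticeWeight s m ^ 2 ≤ 9 * Real.pi ^ (d + 1) := by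
  refine ((summable_sq_latticeWeight hs).tsum_le_of_sum_le (sum_sq_latticeWeight_le hs)).trans ?_
  rcases d with _ | d
  · norm_num
    positivity
  · calc 2 * ((d + 1 : ℕ) : ℝ) * 3 ^ (d + 1 - 1) * (Real.pi ^ 2 / 6)
        = ((d + 1 : ℕ) : ℝ) * 3 ^ (d + 1 - 1) * (Real.pi ^ 2 / 3) := by ring
      _ ≤ 27 * Real.pi ^ (d + 1 - 1) * (Real.pi ^ 2 / 3) := by
          gcongr ?_ * _
          exact natCast_mul_three_pow_le (d + 1)
      _ = 9 * Real.pi ^ (d + 1 + 1) := by rw [Nat.add_sub_cancel]; ring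

/-- The constant `(∑_m |m|^{-4s})^{1/2} / π^{2s}` of the aliasing estimates. -/
def aliasingConst (d s : ℕ) : ℝ :=
  √(∑' m : Fin d → ℤ, latticeWeight s m ^ 2) / Real.pi ^ (2 * s)

theorem aliasingConst_nonneg (d s : ℕ) : 0 ≤ aliasingConst d s := by
  unfold aliasingConst
  positivity

theorem aliasingConst_add_le {s : ℕ} (hs : d < 4 * s) (k : ℕ) :
    aliasingConst d (s + k) ≤ 3 / Real.pi ^ (2 * k) := by
  rw [aliasingConst, mul_add, pow_add, div_mul_eq_div_div]
  gcongr
  rw [div_le_iff₀ (by positivity), Real.sqrt_le_left (by positivity), mul_pow, ← pow_mul,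
    show (3 : ℝ) ^ 2 = 9 by norm_num]
  refine (tsum_sq_latticeWeight_le (by omega)).trans ?_
  gcongr
  · linarith [Real.pi_gt_three]
  · omega

section FiberSum

variable {ι μ : Type*}

theorem summable_mul_of_summable_sq {b w : ι → ℝ} (hb : Summable fun i => b i ^ 2)
    (hw : Summable fun i => w i ^ 2) : Summable fun i => b i * w i := by
  refine (hb.add hw).of_norm_bounded fun i => ?_
  rw [Real.norm_eq_abs, abs_mul, ← sq_abs (b i), ← sq_abs (w i)]
  nlinarith [sq_nonneg (|b i| - |w i|), sq_nonneg |b i|, sq_nonneg |w i|]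

theorem norm_tsum_sq_le {a : ι → ℂ} {b w : ι → ℝ} (ha : ∀ i, ‖a i‖ ≤ b i * w i)
    (hb : Summable fun i => b i ^ 2) (hw : Summable fun i => w i ^ 2) :
    ‖∑' i, a i‖ ^ 2 ≤ (∑' i, b i ^ 2) * ∑' i, w i ^ 2 := by
  have hsum := (summable_mul_of_summable_sq hb hw).of_nonneg_of_le (fun _ => norm_nonneg _) ha
  rw [← Real.le_sqrt (norm_nonneg _)
    (mul_nonneg (tsum_nonneg fun _ => sq_nonneg _) (tsum_nonneg fun _ => sq_nonneg _))]
  refine (norm_tsum_le_tsum_norm hsum).trans (hsum.tsum_le_of_sum_le fun S => ?_)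
  apply Real.le_sqrt_of_sq_le
  calc (∑ i ∈ S, ‖a i‖) ^ 2 ≤ (∑ i ∈ S, b i * w i) ^ 2 := by
        gcongr with i
        exact ha i
    _ ≤ (∑ i ∈ S, b i ^ 2) * ∑ i ∈ S, w i ^ 2 := Finset.sum_mul_sq_le_sq_mul_sq _ _ _
    _ ≤ (∑' i, b i ^ 2) * ∑' i, w i ^ 2 :=
        mul_le_mul (hb.sum_le_tsum _ fun _ _ => sq_nonneg _)
          (hw.sum_le_tsum _ fun _ _ => sq_nonneg _) (Finset.sum_nonneg fun _ _ => sq_nonneg _)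
          (tsum_nonneg fun _ => sq_nonneg _)

theorem tsum_norm_sq_le_mul {a : ι × μ → ℂ} {b : ι × μ → ℝ} {w : μ → ℝ}
    (ha : ∀ q, ‖a q‖ ≤ b q * w q.2) (hb : Summable fun q => b q ^ 2)
    (hw : Summable fun m => w m ^ 2) :
    ∑' q, ‖a q‖ ^ 2 ≤ (∑' q, b q ^ 2) * ∑' m, w m ^ 2 := by
  have hle (q : ι × μ) : ‖a q‖ ^ 2 ≤ b q ^ 2 * ∑' m, w m ^ 2 := by
    calc ‖a q‖ ^ 2 ≤ (b q * w q.2) ^ 2 := by gcongr; exact ha q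
      _ = b q ^ 2 * w q.2 ^ 2 := mul_pow _ _ _
      _ ≤ b q ^ 2 * ∑' m, w m ^ 2 := by
          gcongr
          exact hw.le_tsum q.2 fun _ _ => sq_nonneg _
  have hbW := hb.mul_right (∑' m, w m ^ 2)
  rw [← tsum_mul_right]
  exact (hbW.of_nonneg_of_le (fun _ => sq_nonneg _) hle).tsum_le_tsum hle hbW

variable [Fintype ι]

/-- The vector of sums of a double family over its second index. It collects the amplitudes of
all wave vectors that are aliases of each other on the grid. -/
def fiberSum (a : ι × μ → ℂ) : EuclideanSpace ℂ ι := WithLp.toLp 2 fun κ => ∑' m, a (κ, m)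

theorem norm_sq_fiberSum_le {a : ι × μ → ℂ} {b : ι × μ → ℝ} {w : μ → ℝ}
    (ha : ∀ q, ‖a q‖ ≤ b q * w q.2) (hb : Summable fun q => b q ^ 2)
    (hw : Summable fun m => w m ^ 2) :
    ‖fiberSum a‖ ^ 2 ≤ (∑' q, b q ^ 2) * ∑' m, w m ^ 2 := by
  rw [EuclideanSpace.norm_sq_eq, hb.tsum_prod, tsum_fintype, Finset.sum_mul]
  exact Finset.sum_le_sum fun κ _ => norm_tsum_sq_le (fun m => ha (κ, m)) (hb.prod_factor κ) hw

theorem sqrt_tsum_norm_sq_le_norm_fiberSum_add {a : ι × μ → ℂ} {b : ι × μ → ℝ} {w : μ → ℝ}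
    (o : μ) (hb₀ : ∀ q, 0 ≤ b q) (hw₀ : 0 ≤ w o) (ha₁ : Summable a)
    (ha₂ : Summable fun q => ‖a q‖ ^ 2) (ha : ∀ q, q.2 ≠ o → ‖a q‖ ≤ b q * w q.2)
    (hb : Summable fun q => b q ^ 2) (hw : Summable fun m => w m ^ 2) :
    √(∑' q, ‖a q‖ ^ 2) ≤ ‖fiberSum a‖ + 2 * √((∑' q, b q ^ 2) * ∑' m, w m ^ 2) := by
  classical
  let head : EuclideanSpace ℂ ι := WithLp.toLp 2 fun κ => a (κ, o)
  let tail : ι × μ → ℂ := fun q => if q.2 = o then 0 else a q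
  have htail (q : ι × μ) : ‖tail q‖ ≤ b q * w q.2 := by
    by_cases hq : q.2 = o
    · simpa [tail, hq] using mul_nonneg (hb₀ q) hw₀
    · simpa [tail, hq] using ha q hq
  have hbw := tsum_norm_sq_le_mul htail hb hw
  have htail₂ : Summable fun q => ‖tail q‖ ^ 2 := by
    refine ha₂.of_nonneg_of_le (fun _ => sq_nonneg _) fun q => ?_
    by_cases hq : q.2 = o <;> simp [tail, hq]
  have hsum : fiberSum a = head + fiberSum tail := by
    ext κ
    exact (ha₁.prod_factor κ).tsum_eq_add_tsum_ite o
  have hsq : ∑' q, ‖a q‖ ^ 2 = ‖head‖ ^ 2 + ∑' q, ‖tail q‖ ^ 2 := by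
    rw [ha₂.tsum_prod, htail₂.tsum_prod, tsum_fintype, tsum_fintype, EuclideanSpace.norm_sq_eq,
      ← Finset.sum_add_distrib]
    refine Finset.sum_congr rfl fun κ _ => ?_
    rw [(ha₂.prod_factor κ).tsum_eq_add_tsum_ite o]
    simp only [head, tail, apply_ite norm, norm_zero, ite_pow, zero_pow two_ne_zero]
  calc √(∑' q, ‖a q‖ ^ 2) ≤ ‖head‖ + √(∑' q, ‖tail q‖ ^ 2) := by
        rw [hsq, Real.sqrt_le_left (by positivity)]
        have htail₀ : √(∑' q, ‖tail q‖ ^ 2) ^ 2 = ∑' q, ‖tail q‖ ^ 2 :=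
          Real.sq_sqrt (tsum_nonneg fun _ => sq_nonneg _)
        nlinarith [mul_nonneg (norm_nonneg head) (Real.sqrt_nonneg (∑' q, ‖tail q‖ ^ 2))]
    _ = ‖fiberSum a - fiberSum tail‖ + √(∑' q, ‖tail q‖ ^ 2) := by
        rw [hsum, add_sub_cancel_right]
    _ ≤ ‖fiberSum a‖ + √((∑' q, b q ^ 2) * ∑' m, w m ^ 2) +
          √((∑' q, b q ^ 2) * ∑' m, w m ^ 2) :=
        add_le_add ((norm_sub_le _ _).trans (add_le_add_right
          (Real.le_sqrt_of_sq_le (norm_sq_fiberSum_le htail hb hw)) _)) (Real.sqrt_le_sqrt hbw)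
    _ = _ := by ring

end FiberSum

/-! ### Aliasing estimates -/

variable {s : ℕ} {f : EuclideanSpace ℝ (Fin d) → ℝ}

theorem torusL2Norm_nonneg (L : ℝ) (f : EuclideanSpace ℝ (Fin d) → ℝ) : 0 ≤ torusL2Norm L f :=
  Real.sqrt_nonneg _

theorem mFourier_torusMk_gridPoint (hL : 0 < L) (k : Fin d → ℤ) (j : Fin d → Fin N) :
    mFourier k (torusMk L (gridPoint L j)) = gridMode N k j := by
  rw [mFourier_torusMk]
  simp only [gridMode, wave, gridPoint]
  refine Finset.prod_congr rfl fun i _ => ?_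
  have hL' : (L : ℂ) ≠ 0 := Complex.ofReal_ne_zero.2 hL.ne'
  congr 2
  push_cast
  field_simp

theorem hasSum_torusFourierCoeff_smul_gridMode (hL : 0 < L) (hf : IsTorusPeriodic L f)
    (hc : Continuous f) (h : Summable (torusFourierCoeff L f)) :
    HasSum (fun k => torusFourierCoeff L f k • gridMode N k) (gridVector N L f) := by
  have hcoord : HasSum (fun k j => torusFourierCoeff L f k * gridMode N k j)
      (fun j : Fin d → Fin N => (f (gridPoint L j) : ℂ)) := Pi.hasSum.2 fun j => by
    simpa only [mFourier_torusMk_gridPoint hL]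
      using hasSum_torusFourierCoeff_mul hL hf hc h (gridPoint L j)
  exact (EuclideanSpace.equiv (Fin d → Fin N) ℂ).symm.hasSum.2 hcoord

theorem norm_sq_of_hasSum_smul_gridMode [NeZero N] {a : (Fin d → Fin N) × (Fin d → ℤ) → ℂ}
    {v : EuclideanSpace ℂ (Fin d → Fin N)} (ha : Summable a)
    (hv : HasSum (fun q => a q • gridMode N (aliasEquiv d N q)) v) :
    ‖v‖ ^ 2 = (N : ℝ) ^ d * ‖fiberSum a‖ ^ 2 := by
  have hfiber (κ : Fin d → Fin N) :
      HasSum (fun m => a (κ, m) • gridMode N (aliasEquiv d N (κ, m)))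
        (fiberSum a κ • gridMode N (aliasEquiv d N (κ, 0))) := by
    simp_rw [gridMode_aliasEquiv]
    exact (ha.prod_factor κ).hasSum.smul_const _
  rw [(hv.prod_fiberwise hfiber).unique (hasSum_fintype _), norm_sq_sum_smul_gridMode]

theorem two_mul_abs_sub_half_le (κ : Fin N) : 2 * |((κ : ℕ) : ℤ) - (N / 2 : ℕ)| ≤ N := by
  have := κ.2
  rcases abs_cases (((κ : ℕ) : ℤ) - (N / 2 : ℕ)) with h | h <;> omega

theorem mul_abs_le_two_mul_abs_add {a b : ℤ} (ha : 2 * |a| ≤ N) :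
    N * |b| ≤ 2 * |a + N * b| := by
  rcases eq_or_ne b 0 with rfl | hb
  · simp
  · have htri : |(N : ℤ) * b| ≤ |a + N * b| + |a| := by
      simpa using abs_sub (a + N * b) a
    rw [abs_mul, Nat.abs_cast] at htri
    nlinarith [Int.one_le_abs hb]

theorem abs_le_abs_add_mul {a b : ℤ} (ha : 2 * |a| ≤ N) : |a| ≤ |a + N * b| := by
  rcases eq_or_ne b 0 with rfl | hb
  · simp
  · have := mul_abs_le_two_mul_abs_add (b := b) ha
    nlinarith [Int.one_le_abs hb]

theorem laplacianSymbol_aliasEquiv_zero_le [NeZero N] (κ : Fin d → Fin N) (m : Fin d → ℤ) :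
    laplacianSymbol L (aliasEquiv d N (κ, 0)) ≤ laplacianSymbol L (aliasEquiv d N (κ, m)) := by
  refine mul_le_mul_of_nonneg_left (Finset.sum_le_sum fun i _ => sq_le_sq.2 ?_) (sq_nonneg _)
  simp only [aliasEquiv_apply, Pi.zero_apply, mul_zero, add_zero]
  exact_mod_cast abs_le_abs_add_mul (b := m i) (two_mul_abs_sub_half_le (κ i))

theorem mul_nsq_le_laplacianSymbol_aliasEquiv [NeZero N] (κ : Fin d → Fin N) (m : Fin d → ℤ) :
    (Real.pi * N / L) ^ 2 * nsq m ≤ laplacianSymbol L (aliasEquiv d N (κ, m)) := by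
  rw [laplacianSymbol, nsq, nsq, Finset.mul_sum, Finset.mul_sum]
  refine Finset.sum_le_sum fun i _ => ?_
  have hhalf : (N : ℝ) * |(m i : ℝ)| ≤ 2 * |(aliasEquiv d N (κ, m) i : ℝ)| := by
    rw [aliasEquiv_apply]
    exact_mod_cast mul_abs_le_two_mul_abs_add (b := m i) (two_mul_abs_sub_half_le (κ i))
  calc (Real.pi * N / L) ^ 2 * (m i : ℝ) ^ 2 = (Real.pi / L) ^ 2 * (N * |(m i : ℝ)|) ^ 2 := by
        rw [mul_pow (N : ℝ), sq_abs]
        ring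
    _ ≤ (Real.pi / L) ^ 2 * (2 * |(aliasEquiv d N (κ, m) i : ℝ)|) ^ 2 := by gcongr
    _ = (2 * Real.pi / L) ^ 2 * (aliasEquiv d N (κ, m) i : ℝ) ^ 2 := by
        rw [mul_pow 2, sq_abs]
        ring

theorem hasSum_sq_norm_torusFourierCoeff_iteratedLaplacian (hL : 0 < L)
    (hf : IsTorusCk L (2 * s) f) :
    HasSum (fun k => ‖torusFourierCoeff L (iteratedLaplacian s f) k‖ ^ 2)
      ((L ^ d)⁻¹ * torusL2Norm L (iteratedLaplacian s f) ^ 2) := by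
  have hlap : IsTorusCk L 0 (iteratedLaplacian s f) :=
    IsTorusCk.iteratedLaplacian s (by simpa using hf)
  exact hasSum_sq_norm_torusFourierCoeff hL hlap.1 hlap.2.continuous

theorem norm_torusFourierCoeff_le (hL : 0 < L) (hf : IsTorusCk L (2 * s) f) {y : ℝ} (hy : 0 < y)
    {k m : Fin d → ℤ} (hm : m ≠ 0) (hk : y * nsq m ≤ laplacianSymbol L k) :
    ‖torusFourierCoeff L f k‖ ≤
      ‖torusFourierCoeff L (iteratedLaplacian s f) k‖ * ((y⁻¹) ^ s * latticeWeight s m) := by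
  have hm' : 0 < nsq m := one_pos.trans_le (one_le_nsq hm)
  have hone : 1 ≤ laplacianSymbol L k ^ s * ((y⁻¹) ^ s * latticeWeight s m) := by
    rw [latticeWeight, ← mul_pow, ← mul_pow, ← mul_inv, ← div_eq_mul_inv]
    exact one_le_pow₀ ((one_le_div (by positivity)).2 hk)
  rw [norm_torusFourierCoeff_iteratedLaplacian hL s hf, mul_right_comm]
  exact le_mul_of_one_le_left (norm_nonneg _) hone

theorem summable_torusFourierCoeff (hL : 0 < L) (hs : d < 4 * s) (hf : IsTorusCk L (2 * s) f) :
    Summable (torusFourierCoeff L f) := by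
  have hy : 0 < (2 * Real.pi / L) ^ 2 := by positivity
  have hbound : Summable fun k => ‖torusFourierCoeff L (iteratedLaplacian s f) k‖ *
      ((((2 * Real.pi / L) ^ 2)⁻¹) ^ s * latticeWeight s k) :=
    summable_mul_of_summable_sq
      (hasSum_sq_norm_torusFourierCoeff_iteratedLaplacian hL hf).summable
      (by simpa only [mul_pow] using (summable_sq_latticeWeight hs).mul_left _)
  refine hbound.of_norm_bounded_eventually ?_
  filter_upwards [(Set.finite_singleton (0 : Fin d → ℤ)).eventually_cofinite_notMem] with k hk
  exact norm_torusFourierCoeff_le hL hf hy hk le_rfl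

/-- The bound on the frequencies aliased by `m`, relative to `∇^{2s} f`: since these are at least
`πN|m|/L`, a factor `(πN|m|/L)^{-2s}`. -/
def aliasWeight (L : ℝ) (N s : ℕ) (m : Fin d → ℤ) : ℝ :=
  (((Real.pi * N / L) ^ 2)⁻¹) ^ s * latticeWeight s m

theorem aliasWeight_nonneg (L : ℝ) (N s : ℕ) (m : Fin d → ℤ) : 0 ≤ aliasWeight L N s m :=
  mul_nonneg (by positivity) (latticeWeight_nonneg s m)

theorem hasSum_sq_aliasWeight (hs : d < 4 * s) :
    HasSum (fun m : Fin d → ℤ => aliasWeight L N s m ^ 2)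
      ((aliasingConst d s * (L / N) ^ (2 * s)) ^ 2) := by
  have hconst : ((((Real.pi * N / L) ^ 2)⁻¹) ^ s) ^ 2 * ∑' m : Fin d → ℤ, latticeWeight s m ^ 2 =
      (aliasingConst d s * (L / N) ^ (2 * s)) ^ 2 := by
    have hroot : √(∑' m : Fin d → ℤ, latticeWeight s m ^ 2) ^ 2 =
        ∑' m : Fin d → ℤ, latticeWeight s m ^ 2 := Real.sq_sqrt (tsum_nonneg fun _ => sq_nonneg _)
    have hbase : (((Real.pi * N / L) ^ 2)⁻¹) ^ s = (L / N) ^ (2 * s) / Real.pi ^ (2 * s) := by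
      rw [← inv_pow, inv_div, ← pow_mul, ← div_pow, div_div, mul_comm Real.pi]
    rw [mul_pow (aliasingConst d s), aliasingConst, div_pow √(_), hroot, hbase]
    ring
  simp only [aliasWeight, mul_pow _ (latticeWeight s _), ← hconst]
  exact (summable_sq_latticeWeight hs).hasSum.mul_left _

theorem norm_torusFourierCoeff_aliasEquiv_le [NeZero N] (hL : 0 < L) (hf : IsTorusCk L (2 * s) f)
    (q : (Fin d → Fin N) × (Fin d → ℤ)) (hq : q.2 ≠ 0) :
    ‖torusFourierCoeff L f (aliasEquiv d N q)‖ ≤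
      ‖torusFourierCoeff L (iteratedLaplacian s f) (aliasEquiv d N q)‖ * aliasWeight L N s q.2 := by
  have hN : (0 : ℝ) < N := Nat.cast_pos.2 (NeZero.pos N)
  exact norm_torusFourierCoeff_le hL hf (by positivity) hq
    (mul_nsq_le_laplacianSymbol_aliasEquiv q.1 q.2)

theorem hasSum_torusFourierCoeff_aliasEquiv [NeZero N] (hL : 0 < L) (hs : d < 4 * s)
    (hf : IsTorusCk L (2 * s) f) :
    HasSum (fun q => torusFourierCoeff L f (aliasEquiv d N q) • gridMode N (aliasEquiv d N q))
      (gridVector N L f) :=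
  (aliasEquiv d N).hasSum_iff.2 <| hasSum_torusFourierCoeff_smul_gridMode hL hf.1 hf.2.continuous
    (summable_torusFourierCoeff hL hs hf)

theorem hasSum_sq_norm_torusFourierCoeff_aliasEquiv [NeZero N] (hL : 0 < L)
    (hf : IsTorusCk L (2 * s) f) :
    HasSum (fun q => ‖torusFourierCoeff L (iteratedLaplacian s f) (aliasEquiv d N q)‖ ^ 2)
      ((L ^ d)⁻¹ * torusL2Norm L (iteratedLaplacian s f) ^ 2) :=
  (aliasEquiv d N).hasSum_iff.2 (hasSum_sq_norm_torusFourierCoeff_iteratedLaplacian hL hf)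

theorem sqrt_mul_torusL2Norm_le_norm_gridVector [NeZero N] (hL : 0 < L) (hs : d < 4 * s)
    (hf : IsTorusCk L (2 * s) f) :
    √((N / L) ^ d) * (torusL2Norm L f -
        2 * (aliasingConst d s * (L / N) ^ (2 * s) * torusL2Norm L (iteratedLaplacian s f))) ≤
      ‖gridVector N L f‖ := by
  have hsum : Summable fun q => torusFourierCoeff L f (aliasEquiv d N q) :=
    (aliasEquiv d N).summable_iff.2 (summable_torusFourierCoeff hL hs hf)
  have hsq : HasSum (fun q => ‖torusFourierCoeff L f (aliasEquiv d N q)‖ ^ 2)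
      ((L ^ d)⁻¹ * torusL2Norm L f ^ 2) :=
    (aliasEquiv d N).hasSum_iff.2 (hasSum_sq_norm_torusFourierCoeff hL hf.1 hf.2.continuous)
  have hderiv := hasSum_sq_norm_torusFourierCoeff_aliasEquiv (N := N) hL hf
  have hweight := hasSum_sq_aliasWeight (d := d) (L := L) (N := N) hs
  have hfiber := sqrt_tsum_norm_sq_le_norm_fiberSum_add 0 (fun _ => norm_nonneg _)
    (aliasWeight_nonneg L N s 0) hsum hsq.summable
    (norm_torusFourierCoeff_aliasEquiv_le hL hf) hderiv.summable hweight.summable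
  have hA : 0 ≤ aliasingConst d s * (L / N) ^ (2 * s) :=
    mul_nonneg (aliasingConst_nonneg d s) (by positivity)
  have hnorm : ‖gridVector N L f‖ = √((N : ℝ) ^ d) *
      ‖fiberSum fun q => torusFourierCoeff L f (aliasEquiv d N q)‖ := by
    rw [← Real.sqrt_sq (norm_nonneg (gridVector N L f)), norm_sq_of_hasSum_smul_gridMode hsum
      (hasSum_torusFourierCoeff_aliasEquiv hL hs hf), Real.sqrt_mul (by positivity),
      Real.sqrt_sq (norm_nonneg _)]
  rw [hsq.tsum_eq, hderiv.tsum_eq, hweight.tsum_eq, Real.sqrt_mul (by positivity),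
    Real.sqrt_sq (torusL2Norm_nonneg L f), mul_assoc (L ^ d)⁻¹, ← mul_pow,
    Real.sqrt_mul (by positivity), Real.sqrt_sq (mul_nonneg (torusL2Norm_nonneg L _) hA)] at hfiber
  rw [hnorm, div_pow, div_eq_mul_inv, Real.sqrt_mul (by positivity), mul_assoc]
  gcongr
  linarith

/-- The amplitude of the plane wave `aliasEquiv d N q` in `(∇² + 2K) f` on the grid: `2K` acts on it
with the eigenvalue of its alias in the Brillouin zone. -/
def aliasDefect (N : ℕ) [NeZero N] (L : ℝ) (f : EuclideanSpace ℝ (Fin d) → ℝ)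
    (q : (Fin d → Fin N) × (Fin d → ℤ)) : ℂ :=
  ((laplacianSymbol L (aliasEquiv d N (q.1, 0)) - laplacianSymbol L (aliasEquiv d N q) : ℝ) : ℂ) *
    torusFourierCoeff L f (aliasEquiv d N q)

theorem hasSum_aliasDefect [NeZero N] (hN : Even N) (hL : 0 < L) (hs : d < 4 * s)
    (hf : IsTorusCk L (2 * (s + 1)) f) :
    HasSum (fun q => aliasDefect N L f q • gridMode N (aliasEquiv d N q))
      (gridVector N L (Laplacian.laplacian f) +
        (2 : ℂ) • (matK d N L).toEuclideanLin (gridVector N L f)) := by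
  have hlap : IsTorusCk L (2 * s) (Laplacian.laplacian f) := IsTorusCk.laplacian hf
  have hK := ((matK d N L).toEuclideanLin.toContinuousLinearMap.hasSum
    (hasSum_torusFourierCoeff_aliasEquiv hL hs (hf.of_le (by omega)))).const_smul (2 : ℂ)
  refine ((hasSum_torusFourierCoeff_aliasEquiv hL hs hlap).add hK).congr_fun fun q => ?_
  simp only [LinearMap.coe_toContinuousLinearMap', map_smul, toEuclideanLin_matK_gridMode hN]
  rw [smul_smul, smul_smul, ← add_smul, torusFourierCoeff_laplacian hL (hf.of_le (by omega)),
    aliasDefect]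
  congr 1
  push_cast
  ring

theorem norm_aliasDefect_le [NeZero N] (hL : 0 < L) (hf : IsTorusCk L 2 f)
    (q : (Fin d → Fin N) × (Fin d → ℤ)) :
    ‖aliasDefect N L f q‖ ≤ ‖torusFourierCoeff L (Laplacian.laplacian f) (aliasEquiv d N q)‖ := by
  have hzero := laplacianSymbol_nonneg L (aliasEquiv d N (q.1, 0))
  have hle := laplacianSymbol_aliasEquiv_zero_le (L := L) q.1 q.2
  rw [norm_torusFourierCoeff_laplacian hL hf, aliasDefect, norm_mul, Complex.norm_real,
    Real.norm_eq_abs]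
  gcongr
  rw [abs_le]
  constructor <;> linarith

theorem norm_aliasDefect_le_mul_aliasWeight [NeZero N] (hL : 0 < L)
    (hf : IsTorusCk L (2 * (s + 1)) f) (q : (Fin d → Fin N) × (Fin d → ℤ)) :
    ‖aliasDefect N L f q‖ ≤
      ‖torusFourierCoeff L (iteratedLaplacian (s + 1) f) (aliasEquiv d N q)‖ *
        aliasWeight L N s q.2 := by
  obtain ⟨κ, m⟩ := q
  rcases eq_or_ne m 0 with rfl | hm
  · simpa [aliasDefect] using mul_nonneg (norm_nonneg _) (aliasWeight_nonneg L N s 0)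
  · exact (norm_aliasDefect_le hL (hf.of_le (by omega)) _).trans
      (norm_torusFourierCoeff_aliasEquiv_le hL (IsTorusCk.laplacian hf) (κ, m) hm)

theorem norm_gridVector_laplacian_add_le [NeZero N] (hN : Even N) (hL : 0 < L) (hs : d < 4 * s)
    (hf : IsTorusCk L (2 * (s + 1)) f) :
    ‖gridVector N L (Laplacian.laplacian f) +
        (2 : ℂ) • (matK d N L).toEuclideanLin (gridVector N L f)‖ ≤
      √((N / L) ^ d) * (aliasingConst d s * (L / N) ^ (2 * s) *
        torusL2Norm L (iteratedLaplacian (s + 1) f)) := by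
  have hderiv := hasSum_sq_norm_torusFourierCoeff_aliasEquiv (N := N) hL hf
  have hweight := hasSum_sq_aliasWeight (d := d) (L := L) (N := N) hs
  have hsum : Summable (aliasDefect N L f) :=
    ((aliasEquiv d N).summable_iff.2 (summable_torusFourierCoeff hL hs
      (IsTorusCk.laplacian hf)).norm).of_norm_bounded (norm_aliasDefect_le hL (hf.of_le (by omega)))
  have hfiber := norm_sq_fiberSum_le (norm_aliasDefect_le_mul_aliasWeight hL hf) hderiv.summable
    hweight.summable
  rw [hderiv.tsum_eq, hweight.tsum_eq] at hfiber
  have hA : 0 ≤ aliasingConst d s * (L / N) ^ (2 * s) :=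
    mul_nonneg (aliasingConst_nonneg d s) (by positivity)
  refine (sq_le_sq₀ (norm_nonneg _) (mul_nonneg (Real.sqrt_nonneg _)
    (mul_nonneg hA (torusL2Norm_nonneg L _)))).1 ?_
  rw [norm_sq_of_hasSum_smul_gridMode hsum (hasSum_aliasDefect hN hL hs hf), mul_pow,
    Real.sq_sqrt (by positivity)]
  calc _ ≤ (N : ℝ) ^ d * _ := mul_le_mul_of_nonneg_left hfiber (by positivity)
    _ = _ := by
      rw [div_pow, div_eq_mul_inv]
      ring

/-! ### Square roots and stability of skew-adjoint evolutions -/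

section SqrtDerivative

variable {S : Set ℝ} {p g : ℝ → ℝ}

theorem abs_sqrt_sub_sqrt_le (hS : Convex ℝ S) (hp : ∀ t ∈ S, 0 ≤ p t)
    (hder : ∀ t ∈ S, HasDerivWithinAt p (2 * √(p t) * g t) S t) {ε : ℝ}
    (hg : ∀ t ∈ S, |g t| ≤ ε) {t y : ℝ} (ht : t ∈ S) (hy : y ∈ S) :
    |√(p y) - √(p t)| ≤ ε * |y - t| := by
  -- `√(p + η²)` is differentiable even where `p` vanishes
  have hregular (η : ℝ) (hη : 0 < η) : |√(p y + η ^ 2) - √(p t + η ^ 2)| ≤ ε * |y - t| := by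
    refine hS.norm_image_sub_le_of_norm_hasDerivWithin_le (f := fun τ => √(p τ + η ^ 2))
      (fun τ hτ => ((hder τ hτ).add_const (η ^ 2)).sqrt ?_) (fun τ hτ => ?_) ht hy
    all_goals have hpτ := hp τ hτ
    · positivity
    · have hpos : 0 < √(p τ + η ^ 2) := by positivity
      have hle : √(p τ) ≤ √(p τ + η ^ 2) := Real.sqrt_le_sqrt (by nlinarith)
      rw [Real.norm_eq_abs, mul_assoc, mul_div_mul_left _ _ two_ne_zero, abs_div, abs_mul,
        abs_of_nonneg (Real.sqrt_nonneg _), abs_of_pos hpos, div_le_iff₀ hpos, mul_comm ε]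
      exact mul_le_mul hle (hg τ hτ) (abs_nonneg _) hpos.le
  have hcont : Continuous fun η : ℝ => |√(p y + η ^ 2) - √(p t + η ^ 2)| := by fun_prop
  have hlim : Tendsto (fun η : ℝ => |√(p y + η ^ 2) - √(p t + η ^ 2)|) (𝓝[>] 0)
      (𝓝 |√(p y) - √(p t)|) := by
    simpa using (hcont.tendsto 0).mono_left nhdsWithin_le_nhds
  exact le_of_tendsto hlim (eventually_mem_nhdsWithin.mono hregular)

theorem hasDerivWithinAt_sqrt_of_eq_zero (hS : Convex ℝ S) (hp : ∀ t ∈ S, 0 ≤ p t)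
    (hder : ∀ t ∈ S, HasDerivWithinAt p (2 * √(p t) * g t) S t) {t : ℝ} (ht : t ∈ S)
    (hg : ContinuousWithinAt g S t) (hgt : g t = 0) :
    HasDerivWithinAt (fun τ => √(p τ)) 0 S t := by
  rw [hasDerivWithinAt_iff_isLittleO, Asymptotics.isLittleO_iff]
  intro ε hε
  have hsmall : ∀ᶠ τ in 𝓝[S] t, |g τ| < ε :=
    hg.abs.eventually_lt_const (by simpa only [hgt, abs_zero] using hε)
  obtain ⟨r, hr, hball⟩ := Metric.mem_nhdsWithin_iff.1 hsmall
  filter_upwards [inter_mem (mem_nhdsWithin_of_mem_nhds (Metric.ball_mem_nhds t hr))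
    self_mem_nhdsWithin] with y hy
  have hlipschitz := abs_sqrt_sub_sqrt_le ((convex_ball t r).inter hS) (fun τ hτ => hp τ hτ.2)
    (fun τ hτ => (hder τ hτ.2).mono Set.inter_subset_right) (fun τ hτ => (hball hτ).le)
    ⟨Metric.mem_ball_self hr, ht⟩ hy
  simpa only [smul_zero, sub_zero, Real.norm_eq_abs] using hlipschitz

theorem hasDerivWithinAt_sqrt (hS : Convex ℝ S) (hp : ∀ t ∈ S, 0 ≤ p t)
    (hder : ∀ t ∈ S, HasDerivWithinAt p (2 * √(p t) * g t) S t) {t : ℝ} (ht : t ∈ S)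
    (hg : ContinuousWithinAt g S t) (hgt : p t = 0 → g t = 0) :
    HasDerivWithinAt (fun τ => √(p τ)) (g t) S t := by
  by_cases hpt : p t = 0
  · rw [hgt hpt]
    exact hasDerivWithinAt_sqrt_of_eq_zero hS hp hder ht hg (hgt hpt)
  · have hpos : 0 < √(p t) := Real.sqrt_pos.2 ((hp t ht).lt_of_ne' hpt)
    convert! (hder t ht).sqrt hpt using 1
    field_simp

end SqrtDerivative

section Stability

variable {E : Type*} [NormedAddCommGroup E] [InnerProductSpace ℝ E] {A : ℝ → E →ₗ[ℝ] E}

theorem norm_le_of_hasDerivWithinAt_skew {T ε : ℝ} (hT : 0 ≤ T) {w r : ℝ → E}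
    (hA : ∀ t x, ⟪x, A t x⟫_ℝ = 0)
    (hw : ∀ t ∈ Set.Icc 0 T, HasDerivWithinAt w (A t (w t) + r t) (Set.Icc 0 T) t)
    (hr : ∀ t ∈ Set.Icc 0 T, ‖r t‖ ≤ ε) : ‖w T‖ ≤ ‖w 0‖ + T * ε := by
  refine le_of_forall_pos_le_add fun η hη => ?_
  -- `√(‖w‖² + η²)` is differentiable even where `w` vanishes
  let h : ℝ → ℝ := fun t => √(‖w t‖ ^ 2 + η ^ 2) - t * ε
  have hder (t : ℝ) (ht : t ∈ Set.Icc 0 T) : HasDerivWithinAt h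
      (2 * ⟪w t, A t (w t) + r t⟫_ℝ / (2 * √(‖w t‖ ^ 2 + η ^ 2)) - 1 * ε) (Set.Icc 0 T) t :=
    (((hw t ht).norm_sq.add_const (η ^ 2)).sqrt (by positivity)).sub
      ((hasDerivWithinAt_id t _).mul_const ε)
  have hle_sqrt (t : ℝ) : ‖w t‖ ≤ √(‖w t‖ ^ 2 + η ^ 2) := Real.le_sqrt_of_sq_le (by nlinarith)
  have hanti : AntitoneOn h (Set.Icc 0 T) := by
    refine antitoneOn_of_hasDerivWithinAt_nonpos (convex_Icc 0 T)
      (fun t ht => (hder t ht).continuousWithinAt)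
      (fun t ht => (hder t (interior_subset ht)).mono interior_subset) fun t ht => ?_
    rw [inner_add_right, hA, zero_add, one_mul, sub_nonpos, mul_div_mul_left _ _ two_ne_zero,
      div_le_iff₀ (by positivity), mul_comm ε]
    exact (real_inner_le_norm _ _).trans
      (mul_le_mul (hle_sqrt t) (hr t (interior_subset ht)) (norm_nonneg _) (Real.sqrt_nonneg _))
  have hcompare := hanti (Set.left_mem_Icc.2 hT) (Set.right_mem_Icc.2 hT) hT
  simp only [h, zero_mul, sub_zero] at hcompare
  have hinitial : √(‖w 0‖ ^ 2 + η ^ 2) ≤ ‖w 0‖ + η :=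
    Real.sqrt_le_left (by positivity) |>.2 (by nlinarith [mul_nonneg (norm_nonneg (w 0)) hη.le])
  linarith [hle_sqrt T]

theorem norm_sub_inner_div_sq_smul_le (u e : E) :
    ‖e - (⟪u, e⟫_ℝ / ‖u‖ ^ 2) • u‖ ≤ ‖e‖ := by
  rcases eq_or_ne u 0 with rfl | hu
  · simp
  · have hu' := norm_ne_zero_iff.2 hu
    refine (sq_le_sq₀ (norm_nonneg _) (norm_nonneg _)).1 ?_
    have hpythagoras : ‖e - (⟪u, e⟫_ℝ / ‖u‖ ^ 2) • u‖ ^ 2 =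
        ‖e‖ ^ 2 - (⟪u, e⟫_ℝ / ‖u‖) ^ 2 := by
      rw [norm_sub_sq_real, inner_smul_right, real_inner_comm, norm_smul, mul_pow, Real.norm_eq_abs,
        sq_abs]
      field_simp
      ring
    linarith [sq_nonneg (⟪u, e⟫_ℝ / ‖u‖)]

theorem hasDerivWithinAt_inv_norm_smul {B : E →ₗ[ℝ] E} (hB : ∀ x, ⟪x, B x⟫_ℝ = 0) {u : ℝ → E}
    {e : E} {S : Set ℝ} {t : ℝ} (hu : HasDerivWithinAt u (B (u t) + e) S t) (hut : u t ≠ 0) :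
    HasDerivWithinAt (fun τ => ‖u τ‖⁻¹ • u τ)
      (B (‖u t‖⁻¹ • u t) + ‖u t‖⁻¹ • (e - (⟪u t, e⟫_ℝ / ‖u t‖ ^ 2) • u t)) S t := by
  have hn := norm_ne_zero_iff.2 hut
  have hnorm : HasDerivWithinAt (fun τ => ‖u τ‖) (⟪u t, e⟫_ℝ / ‖u t‖) S t := by
    have hsqrt := hu.norm_sq.sqrt (pow_ne_zero 2 hn)
    simp only [Real.sqrt_sq (norm_nonneg _)] at hsqrt
    convert! hsqrt using 1
    rw [inner_add_right, hB, zero_add, mul_div_mul_left _ _ two_ne_zero]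
  convert! (hnorm.inv hn).smul hu using 1
  have hcoef : -(⟪u t, e⟫_ℝ / ‖u t‖) / ‖u t‖ ^ 2 = -(‖u t‖⁻¹ * (⟪u t, e⟫_ℝ / ‖u t‖ ^ 2)) := by
    field_simp
  rw [hcoef, map_smul, Pi.inv_apply]
  module

theorem norm_inv_norm_smul_sub_le {T ε : ℝ} (hT : 0 ≤ T) {u e φ : ℝ → E}
    (hA : ∀ t x, ⟪x, A t x⟫_ℝ = 0)
    (hu : ∀ t ∈ Set.Icc 0 T, HasDerivWithinAt u (A t (u t) + e t) (Set.Icc 0 T) t)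
    (hφ : ∀ t ∈ Set.Icc 0 T, HasDerivWithinAt φ (A t (φ t)) (Set.Icc 0 T) t)
    (hu0 : ∀ t ∈ Set.Icc 0 T, u t ≠ 0) (he : ∀ t ∈ Set.Icc 0 T, ‖e t‖ ≤ ε * ‖u t‖) :
    ‖‖u T‖⁻¹ • u T - φ T‖ ≤ ‖‖u 0‖⁻¹ • u 0 - φ 0‖ + T * ε := by
  refine norm_le_of_hasDerivWithinAt_skew (w := fun t => ‖u t‖⁻¹ • u t - φ t)
    (r := fun t => ‖u t‖⁻¹ • (e t - (⟪u t, e t⟫_ℝ / ‖u t‖ ^ 2) • u t)) hT hA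
    (fun t ht => ?_) fun t ht => ?_
  · convert! (hasDerivWithinAt_inv_norm_smul (hA t) (hu t ht) (hu0 t ht)).sub (hφ t ht) using 1
    rw [map_sub]
    abel
  · rw [norm_smul, norm_inv, norm_norm, inv_mul_le_iff₀ (norm_pos_iff.2 (hu0 t ht)), mul_comm]
    exact (norm_sub_inner_div_sq_smul_le _ _).trans (he t ht)

end Stability

/-! ### The continuity equation in commutator form -/

section ContinuityEquation

variable {f g q V : EuclideanSpace ℝ (Fin d) → ℝ} {x : EuclideanSpace ℝ (Fin d)}

theorem pderiv_mul (hf : DifferentiableAt ℝ f x) (hg : DifferentiableAt ℝ g x) (i : Fin d) :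
    pderiv i (fun y => f y * g y) x = pderiv i f x * g x + f x * pderiv i g x := by
  simp only [pderiv, fderiv_fun_mul hf hg, add_apply, smul_apply, smul_eq_mul]
  ring

theorem pderiv_add (hf : DifferentiableAt ℝ f x) (hg : DifferentiableAt ℝ g x) (i : Fin d) :
    pderiv i (fun y => f y + g y) x = pderiv i f x + pderiv i g x := by
  rw [pderiv, fderiv_fun_add hf hg]
  rfl

theorem gradient_apply_eq_pderiv (f : EuclideanSpace ℝ (Fin d) → ℝ)
    (x : EuclideanSpace ℝ (Fin d)) (i : Fin d) : gradient f x i = pderiv i f x := by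
  calc gradient f x i = ⟪gradient f x, EuclideanSpace.single i (1 : ℝ)⟫_ℝ := by
        rw [EuclideanSpace.inner_single_right, one_mul, RCLike.conj_to_real]
    _ = pderiv i f x := toDual_symm_apply

theorem differentiable_pderiv (hq : ContDiff ℝ 2 q) (i : Fin d) :
    Differentiable ℝ (pderiv i q) :=
  ((hq.fderiv_right (m := 1) (by norm_num)).clm_apply contDiff_const).differentiable one_ne_zero

/-- The time derivative `½(V∇²q - ∇²(Vq))` of `q = √p` when `p` is transported along `∇V`: the
commutator form of the continuity equation, which `discreteHamiltonian` discretizes. -/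
def flowRate (V q : EuclideanSpace ℝ (Fin d) → ℝ) (x : EuclideanSpace ℝ (Fin d)) : ℝ :=
  1 / 2 * (V x * Laplacian.laplacian q x - Laplacian.laplacian (fun y => V y * q y) x)

theorem flowRate_eq_neg_sum (hV : ContDiff ℝ 2 V) (hq : ContDiff ℝ 2 q)
    (x : EuclideanSpace ℝ (Fin d)) :
    flowRate V q x =
      -∑ i, (pderiv i q x * pderiv i V x + 1 / 2 * (q x * pderiv i (pderiv i V) x)) := by
  have hVd : Differentiable ℝ V := hV.differentiable two_ne_zero
  have hqd : Differentiable ℝ q := hq.differentiable two_ne_zero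
  have hV' := differentiable_pderiv hV
  have hq' := differentiable_pderiv hq
  have hfirst (i : Fin d) : pderiv i (fun y => V y * q y) =
      fun y => pderiv i V y * q y + V y * pderiv i q y :=
    funext fun y => pderiv_mul (hVd y) (hqd y) i
  have hsecond (i : Fin d) : pderiv i (pderiv i fun y => V y * q y) x =
      pderiv i (pderiv i V) x * q x + 2 * (pderiv i V x * pderiv i q x) +
        V x * pderiv i (pderiv i q) x := by
    rw [hfirst, pderiv_add (f := fun y => pderiv i V y * q y) (g := fun y => V y * pderiv i q y)
        ((hV' i x).mul (hqd x)) ((hVd x).mul (hq' i x)),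
      pderiv_mul (hV' i x) (hqd x), pderiv_mul (hVd x) (hq' i x)]
    ring
  rw [flowRate, laplacian_eq_sum_pderiv (hV.mul hq), laplacian_eq_sum_pderiv hq, Finset.mul_sum,
    ← Finset.sum_sub_distrib, Finset.mul_sum, ← Finset.sum_neg_distrib]
  refine Finset.sum_congr rfl fun i _ => ?_
  rw [hsecond]
  ring

theorem neg_divergence_mul_self_smul_gradient (hV : ContDiff ℝ 2 V) (hq : ContDiff ℝ 2 q)
    (x : EuclideanSpace ℝ (Fin d)) :
    -divergence (fun y => (q y * q y) • gradient V y) x = 2 * q x * flowRate V q x := by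
  have hqx : DifferentiableAt ℝ q x := hq.differentiable two_ne_zero x
  have hterm (i : Fin d) : pderiv i (fun y => q y * q y * pderiv i V y) x =
      2 * q x * (pderiv i q x * pderiv i V x + 1 / 2 * (q x * pderiv i (pderiv i V) x)) := by
    rw [pderiv_mul (f := fun y => q y * q y) (hqx.mul hqx) (differentiable_pderiv hV i x),
      pderiv_mul hqx hqx]
    ring
  rw [flowRate_eq_neg_sum hV hq, mul_neg, Finset.mul_sum]
  simp only [divergence, PiLp.smul_apply, gradient_apply_eq_pderiv, smul_eq_mul, ← hterm]
  rfl

theorem flowRate_eq_zero (hV : ContDiff ℝ 2 V) (hq : ContDiff ℝ 2 q) (hq0 : ∀ y, 0 ≤ q y)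
    (hx : q x = 0) : flowRate V q x = 0 := by
  have hmin : IsLocalMin q x := Eventually.of_forall fun y => hx.trans_le (hq0 y)
  have hcritical (i : Fin d) : pderiv i q x = 0 := by
    rw [pderiv, hmin.fderiv_eq_zero]
    rfl
  simp [flowRate_eq_neg_sum hV hq, hcritical, hx]

theorem hasDerivWithinAt_sqrtFun {T : ℝ} {p V : ℝ → EuclideanSpace ℝ (Fin d) → ℝ}
    (hp : ∀ t ∈ Set.Icc 0 T, ∀ x, 0 ≤ p t x) (hcont : ContinuityEquation T p V)
    (hpC : ∀ t ∈ Set.Icc 0 T, ContDiff ℝ 2 (sqrtFun (p t)))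
    (hVC : ∀ t ∈ Set.Icc 0 T, ContDiff ℝ 2 (V t))
    (hVt : ∀ x, ContinuousOn (fun t => V t x) (Set.Icc 0 T))
    (hpt : ∀ x, ContinuousOn (fun t => Laplacian.laplacian (sqrtFun (p t)) x) (Set.Icc 0 T))
    (hVpt : ∀ x, ContinuousOn
      (fun t => Laplacian.laplacian (fun y => V t y * sqrtFun (p t) y) x) (Set.Icc 0 T))
    {t : ℝ} (ht : t ∈ Set.Icc 0 T) (x : EuclideanSpace ℝ (Fin d)) :
    HasDerivWithinAt (fun τ => sqrtFun (p τ) x) (flowRate (V t) (sqrtFun (p t)) x)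
      (Set.Icc 0 T) t := by
  have hder (τ : ℝ) (hτ : τ ∈ Set.Icc 0 T) : HasDerivWithinAt (fun τ => p τ x)
      (2 * √(p τ x) * flowRate (V τ) (sqrtFun (p τ)) x) (Set.Icc 0 T) τ := by
    have hdiv := neg_divergence_mul_self_smul_gradient (hVC τ hτ) (hpC τ hτ) x
    simp only [sqrtFun, Real.mul_self_sqrt (hp τ hτ _)] at hdiv
    exact hdiv ▸ hcont τ hτ x
  exact hasDerivWithinAt_sqrt (convex_Icc 0 T) (fun τ hτ => hp τ hτ x) hder ht
    ((((hVt x).mul (hpt x)).sub (hVpt x)).const_mul (1 / 2) t ht)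
    fun h0 => flowRate_eq_zero (hVC t ht) (hpC t ht) (fun _ => Real.sqrt_nonneg _)
      (by rw [sqrtFun, h0, Real.sqrt_zero])

end ContinuityEquation

variable {q V : EuclideanSpace ℝ (Fin d) → ℝ}

theorem torusSupNorm_nonneg (L : ℝ) (V : EuclideanSpace ℝ (Fin d) → ℝ) : 0 ≤ torusSupNorm L V :=
  Real.sSup_nonneg <| by
    rintro _ ⟨y, -, rfl⟩
    exact abs_nonneg _

theorem abs_le_torusSupNorm (hL : 0 < L) (hV : IsTorusPeriodic L V) (hc : Continuous V)
    {x : EuclideanSpace ℝ (Fin d)} (hx : x ∈ cube d L) : |V x| ≤ torusSupNorm L V := by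
  obtain ⟨C, hC⟩ := hV.exists_abs_le hL hc
  exact le_csSup ⟨C, by rintro _ ⟨y, -, rfl⟩; exact hC y⟩ (Set.mem_image_of_mem _ hx)

theorem gridPoint_mem_cube (hL : 0 ≤ L) (j : Fin d → Fin N) : gridPoint L j ∈ cube d L := by
  intro i
  have hN : (0 : ℝ) < N := by exact_mod_cast (j i).pos
  have hj : ((j i : ℕ) : ℝ) ≤ N := by exact_mod_cast (j i).2.le
  simp only [gridPoint, div_mul_eq_mul_div]
  exact ⟨by positivity, (div_le_iff₀ hN).2 (mul_le_mul_of_nonneg_left hj hL)⟩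

theorem toEuclideanLin_matDV_apply (V : EuclideanSpace ℝ (Fin d) → ℝ)
    (v : EuclideanSpace ℂ (Fin d → Fin N)) (j : Fin d → Fin N) :
    (matDV N L V).toEuclideanLin v j = (V (gridPoint L j) : ℂ) * v j :=
  Matrix.mulVec_diagonal _ _ _

theorem norm_toEuclideanLin_matDV_le (hL : 0 < L) (hV : IsTorusPeriodic L V) (hc : Continuous V)
    (v : EuclideanSpace ℂ (Fin d → Fin N)) :
    ‖(matDV N L V).toEuclideanLin v‖ ≤ torusSupNorm L V * ‖v‖ := by
  refine (sq_le_sq₀ (norm_nonneg _)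
    (mul_nonneg (torusSupNorm_nonneg L V) (norm_nonneg _))).1 ?_
  rw [mul_pow, EuclideanSpace.norm_sq_eq, EuclideanSpace.norm_sq_eq, Finset.mul_sum]
  refine Finset.sum_le_sum fun j _ => ?_
  rw [toEuclideanLin_matDV_apply, norm_mul, mul_pow, Complex.norm_real, Real.norm_eq_abs]
  gcongr
  exact abs_le_torusSupNorm hL hV hc (gridPoint_mem_cube hL.le j)

theorem toEuclideanLin_matDV_gridVector (V f : EuclideanSpace ℝ (Fin d) → ℝ) :
    (matDV N L V).toEuclideanLin (gridVector N L f) = gridVector N L (fun x => V x * f x) := by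
  ext j
  rw [toEuclideanLin_matDV_apply, gridVector, gridVector, ← Complex.ofReal_mul]

theorem isHermitian_discreteHamiltonian (N : ℕ) (L : ℝ) (V : EuclideanSpace ℝ (Fin d) → ℝ) :
    (discreteHamiltonian N L V).IsHermitian := by
  have hV : (matDV N L V).IsHermitian :=
    Matrix.isHermitian_diagonal_of_self_adjoint _ (funext fun j => Complex.conj_ofReal _)
  rw [Matrix.IsHermitian, discreteHamiltonian, Matrix.conjTranspose_smul, Matrix.conjTranspose_sub,
    Matrix.conjTranspose_mul, Matrix.conjTranspose_mul, hV, isHermitian_matK]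
  simp only [RCLike.star_def, Complex.conj_I, neg_smul, smul_sub]
  abel

/-- The generator `-i H` of the discrete evolution, as a real-linear map: skew-adjointness
for the real inner product is all that the stability estimate needs. -/
def discreteGenerator (N : ℕ) (L : ℝ) (V : EuclideanSpace ℝ (Fin d) → ℝ) :
    EuclideanSpace ℂ (Fin d → Fin N) →ₗ[ℝ] EuclideanSpace ℂ (Fin d → Fin N) :=
  (-Complex.I • (discreteHamiltonian N L V).toEuclideanLin).restrictScalars ℝ

theorem discreteGenerator_apply (V : EuclideanSpace ℝ (Fin d) → ℝ)
    (v : EuclideanSpace ℂ (Fin d → Fin N)) :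
    discreteGenerator N L V v =
      (matK d N L).toEuclideanLin ((matDV N L V).toEuclideanLin v) -
        (matDV N L V).toEuclideanLin ((matK d N L).toEuclideanLin v) := by
  change -Complex.I • (discreteHamiltonian N L V).toEuclideanLin v = _
  rw [discreteHamiltonian, map_smul, LinearMap.smul_apply, smul_smul, neg_mul, Complex.I_mul_I,
    neg_neg, one_smul, map_sub, LinearMap.sub_apply]
  congr 1 <;>
  · ext j
    change (_ *ᵥ _) j = (_ *ᵥ (_ *ᵥ _)) j
    rw [Matrix.mulVec_mulVec]

theorem inner_discreteGenerator (V : EuclideanSpace ℝ (Fin d) → ℝ)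
    (v : EuclideanSpace ℂ (Fin d → Fin N)) : ⟪v, discreteGenerator N L V v⟫_ℝ = 0 := by
  have him : (⟪v, (discreteHamiltonian N L V).toEuclideanLin v⟫_ℂ).im = 0 := by
    rw [← Complex.conj_eq_iff_im, inner_conj_symm]
    exact Matrix.isSymmetric_toEuclideanLin_iff.2 (isHermitian_discreteHamiltonian N L V) v v
  have hre : ⟪v, discreteGenerator N L V v⟫_ℝ =
      (⟪v, -Complex.I • (discreteHamiltonian N L V).toEuclideanLin v⟫_ℂ).re := by
    rw [PiLp.inner_apply, PiLp.inner_apply, Complex.re_sum]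
    rfl
  rw [hre, inner_smul_right]
  simp [him]

theorem hasDerivWithinAt_gridVector {f : ℝ → EuclideanSpace ℝ (Fin d) → ℝ}
    {f' : EuclideanSpace ℝ (Fin d) → ℝ} {S : Set ℝ} {t : ℝ}
    (h : ∀ x, HasDerivWithinAt (fun τ => f τ x) (f' x) S t) :
    HasDerivWithinAt (fun τ => gridVector N L (f τ)) (gridVector N L f') S t := by
  have hcoord : HasDerivWithinAt (fun τ => fun j : Fin d → Fin N => (f τ (gridPoint L j) : ℂ))
      (fun j => (f' (gridPoint L j) : ℂ)) S t :=
    hasDerivWithinAt_pi.2 fun j => (h (gridPoint L j)).ofReal_comp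
  exact ((EuclideanSpace.equiv (Fin d → Fin N) ℂ).symm.toContinuousLinearMap.restrictScalars
    ℝ).hasFDerivAt.comp_hasDerivWithinAt t hcoord

-- Each bracket compares `∇²` with its pseudo-spectral discretization `-2K`.
theorem gridVector_flowRate_sub_discreteGenerator (V q : EuclideanSpace ℝ (Fin d) → ℝ) :
    gridVector N L (flowRate V q) - discreteGenerator N L V (gridVector N L q) =
      (1 / 2 : ℂ) • ((matDV N L V).toEuclideanLin (gridVector N L (Laplacian.laplacian q) +
          (2 : ℂ) • (matK d N L).toEuclideanLin (gridVector N L q)) -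
        (gridVector N L (Laplacian.laplacian fun x => V x * q x) +
          (2 : ℂ) • (matK d N L).toEuclideanLin (gridVector N L fun x => V x * q x))) := by
  have hflow : gridVector N L (flowRate V q) =
      (1 / 2 : ℂ) • (gridVector N L (fun x => V x * Laplacian.laplacian q x) -
        gridVector N L (Laplacian.laplacian fun x => V x * q x)) := by
    ext j
    simp [gridVector, flowRate]
  rw [hflow, discreteGenerator_apply, toEuclideanLin_matDV_gridVector, map_add,
    toEuclideanLin_matDV_gridVector, map_smul]
  module

theorem norm_gridVector_flowRate_sub_le [NeZero N] (hN : Even N) (hL : 0 < L) (hs : d < 4 * s)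
    (hq : IsTorusCk L (2 * (s + 1)) q) (hV : IsTorusCk L (2 * (s + 1)) V) :
    ‖gridVector N L (flowRate V q) - discreteGenerator N L V (gridVector N L q)‖ ≤
      √((N / L) ^ d) * (aliasingConst d s * (L / N) ^ (2 * s) / 2 *
        (torusSupNorm L V * torusL2Norm L (iteratedLaplacian (s + 1) q) +
          torusL2Norm L (iteratedLaplacian (s + 1) fun x => V x * q x))) := by
  have hVq : IsTorusCk L (2 * (s + 1)) (fun x => V x * q x) :=
    ⟨fun x i => by simp only [hV.1 x i, hq.1 x i], hV.2.mul hq.2⟩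
  have hproduct := norm_gridVector_laplacian_add_le hN hL hs hVq
  have hfactor := (norm_toEuclideanLin_matDV_le hL hV.1 hV.2.continuous _).trans
    (mul_le_mul_of_nonneg_left (norm_gridVector_laplacian_add_le hN hL hs hq)
      (torusSupNorm_nonneg L V))
  have hhalf : ‖(1 / 2 : ℂ)‖ = 1 / 2 := by norm_num
  rw [gridVector_flowRate_sub_discreteGenerator, norm_smul, hhalf]
  calc _ ≤ 1 / 2 * _ :=
        mul_le_mul_of_nonneg_left ((norm_sub_le _ _).trans (add_le_add hfactor hproduct))
          one_half_pos.le
    _ = _ := by ring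

/-! ### The wavefunction flow on the grid -/

variable {p : EuclideanSpace ℝ (Fin d) → ℝ}

theorem errorDensity_nonneg (L : ℝ) (s : ℕ) (p V : EuclideanSpace ℝ (Fin d) → ℝ) :
    0 ≤ errorDensity L s p V :=
  add_nonneg (mul_nonneg (add_nonneg (torusSupNorm_nonneg L V) zero_le_one)
    (torusL2Norm_nonneg L _)) (torusL2Norm_nonneg L _)

theorem torusL2Norm_le_errorDensity (L : ℝ) (s : ℕ) (p V : EuclideanSpace ℝ (Fin d) → ℝ) :
    torusL2Norm L (iteratedLaplacian (s + 1) (sqrtFun p)) ≤ errorDensity L s p V := by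
  rw [errorDensity, add_one_mul]
  linarith [mul_nonneg (torusSupNorm_nonneg L V)
    (torusL2Norm_nonneg L (iteratedLaplacian (s + 1) (sqrtFun p))),
    torusL2Norm_nonneg L (iteratedLaplacian (s + 1) fun x => V x * sqrtFun p x)]

theorem torusSupNorm_mul_add_le_errorDensity (L : ℝ) (s : ℕ)
    (p V : EuclideanSpace ℝ (Fin d) → ℝ) :
    torusSupNorm L V * torusL2Norm L (iteratedLaplacian (s + 1) (sqrtFun p)) +
      torusL2Norm L (iteratedLaplacian (s + 1) fun x => V x * sqrtFun p x) ≤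
        errorDensity L s p V := by
  rw [errorDensity, add_one_mul]
  linarith [torusL2Norm_nonneg L (iteratedLaplacian (s + 1) (sqrtFun p))]

theorem one_le_errorConst (L T : ℝ) (s : ℕ) (p V : ℝ → EuclideanSpace ℝ (Fin d) → ℝ) :
    1 ≤ errorConst L T s p V := by
  refine le_add_of_nonneg_left (mul_nonneg zero_le_three (Real.sSup_nonneg ?_))
  rintro _ ⟨t, -, rfl⟩
  exact errorDensity_nonneg L s (p t) (V t)

theorem three_mul_errorDensity_add_one_le_errorConst {T : ℝ}
    {p V : ℝ → EuclideanSpace ℝ (Fin d) → ℝ}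
    (hbdd : BddAbove ((fun t => errorDensity L s (p t) (V t)) '' Set.Icc 0 T)) {t : ℝ}
    (ht : t ∈ Set.Icc 0 T) : 3 * errorDensity L s (p t) (V t) + 1 ≤ errorConst L T s p V := by
  rw [errorConst]
  gcongr
  exact le_csSup hbdd (Set.mem_image_of_mem _ ht)

theorem torusL2Norm_sqrtFun (hp : IsTorusPDF L p) : torusL2Norm L (sqrtFun p) = 1 := by
  simp only [torusL2Norm, sqrtFun, sq_abs, Real.sq_sqrt (hp.2.1 _), hp.2.2, Real.sqrt_one]

theorem aliasingConst_le_three (hs : d < 4 * s) : aliasingConst d s ≤ 3 := by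
  simpa using aliasingConst_add_le hs 0

theorem aliasingConst_succ_le_third (hs : d < 4 * s) : aliasingConst d (s + 1) ≤ 1 / 3 := by
  refine (aliasingConst_add_le hs 1).trans ?_
  have hpi : (3 : ℝ) ^ 2 ≤ Real.pi ^ (2 * 1) := pow_le_pow_left₀ zero_le_three Real.pi_gt_three.le 2
  rw [div_le_div_iff₀ (by positivity) three_pos]
  linarith

theorem sqrt_le_two_mul_norm_gridVector_sqrtFun [NeZero N] (hL : 0 < L) (hs : d < 4 * s)
    (hp : IsTorusPDF L p) (hpC : IsTorusCk L (2 * (s + 1)) (sqrtFun p))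
    (hV : (3 * errorDensity L s p V + 1) * (L / N) ^ (2 * s) ≤ 1) :
    √((N / L) ^ d) ≤ 2 * ‖gridVector N L (sqrtFun p)‖ := by
  set D := torusL2Norm L (iteratedLaplacian (s + 1) (sqrtFun p)) with hD
  have hD0 : 0 ≤ D := torusL2Norm_nonneg L _
  have hLN0 : 0 ≤ L / N := by positivity
  have hLN : L / N ≤ 1 := (pow_le_one_iff_of_nonneg hLN0 (by omega)).1 <|
    (le_mul_of_one_le_left (by positivity)
      (le_add_of_nonneg_left (mul_nonneg zero_le_three (errorDensity_nonneg L s p V)))).trans hV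
  have hpow : (L / N) ^ (2 * (s + 1)) ≤ (L / N) ^ (2 * s) :=
    pow_le_pow_of_le_one hLN0 hLN (by omega)
  have hXD : (L / N) ^ (2 * s) * D ≤ 1 / 3 := by
    have := mul_le_mul_of_nonneg_right (torusL2Norm_le_errorDensity L s p V)
      (pow_nonneg hLN0 (2 * s))
    nlinarith [pow_nonneg hLN0 (2 * s)]
  have hsmall : aliasingConst d (s + 1) * (L / N) ^ (2 * (s + 1)) * D ≤ 1 / 3 * (1 / 3) :=
    calc _ ≤ 1 / 3 * (L / N) ^ (2 * s) * D := by
          gcongr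
          exact aliasingConst_succ_le_third hs
      _ ≤ _ := by rw [mul_assoc]; gcongr
  have hlow := sqrt_mul_torusL2Norm_le_norm_gridVector (N := N) hL (hs.trans (by omega)) hpC
  rw [torusL2Norm_sqrtFun hp, ← hD] at hlow
  nlinarith [Real.sqrt_nonneg ((N / L : ℝ) ^ d)]

theorem gridVector_sqrtFun_ne_zero [NeZero N] (hL : 0 < L) (hs : d < 4 * s)
    (hp : IsTorusPDF L p) (hpC : IsTorusCk L (2 * (s + 1)) (sqrtFun p))
    (hV : (3 * errorDensity L s p V + 1) * (L / N) ^ (2 * s) ≤ 1) :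
    gridVector N L (sqrtFun p) ≠ 0 := by
  have hN : (0 : ℝ) < N := Nat.cast_pos.2 (NeZero.pos N)
  have hpos : 0 < √((N / L : ℝ) ^ d) := by positivity
  exact norm_pos_iff.1 (by linarith [sqrt_le_two_mul_norm_gridVector_sqrtFun hL hs hp hpC hV])

theorem norm_gridVector_flowRate_sqrtFun_sub_le [NeZero N] (hN : Even N) (hL : 0 < L)
    (hs : d < 4 * s) (hp : IsTorusPDF L p) (hpC : IsTorusCk L (2 * (s + 1)) (sqrtFun p))
    (hVC : IsTorusCk L (2 * (s + 1)) V)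
    (hV : (3 * errorDensity L s p V + 1) * (L / N) ^ (2 * s) ≤ 1) :
    ‖gridVector N L (flowRate V (sqrtFun p)) -
        discreteGenerator N L V (gridVector N L (sqrtFun p))‖ ≤
      3 * errorDensity L s p V * (L / N) ^ (2 * s) * ‖gridVector N L (sqrtFun p)‖ := by
  calc _ ≤ √((N / L) ^ d) * (aliasingConst d s * (L / N) ^ (2 * s) / 2 * _) :=
        norm_gridVector_flowRate_sub_le hN hL hs hpC hVC
    _ ≤ 2 * ‖gridVector N L (sqrtFun p)‖ *
          (3 * (L / N) ^ (2 * s) / 2 * errorDensity L s p V) := by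
        have hA := aliasingConst_nonneg d s
        have hnonneg := add_nonneg (mul_nonneg (torusSupNorm_nonneg L V) (torusL2Norm_nonneg L
          (iteratedLaplacian (s + 1) (sqrtFun p)))) (torusL2Norm_nonneg L
          (iteratedLaplacian (s + 1) fun x => V x * sqrtFun p x))
        gcongr
        · exact sqrt_le_two_mul_norm_gridVector_sqrtFun hL hs hp hpC hV
        · exact aliasingConst_le_three hs
        · exact torusSupNorm_mul_add_le_errorDensity L s p V
    _ = _ := by ring

theorem qsample_eq_smul (N : ℕ) (L : ℝ) (p : EuclideanSpace ℝ (Fin d) → ℝ) :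
    qsample N L p = ‖gridVector N L (sqrtFun p)‖⁻¹ • gridVector N L (sqrtFun p) :=
  Complex.coe_smul _ _

theorem norm_qsample (h : gridVector N L (sqrtFun p) ≠ 0) : ‖qsample N L p‖ = 1 := by
  rw [qsample_eq_smul, norm_smul, norm_inv, norm_norm, inv_mul_cancel₀ (norm_ne_zero_iff.2 h)]

theorem qsample_one (h : gridVector 1 L (sqrtFun p) ≠ 0) :
    qsample 1 L p = WithLp.toLp 2 fun _ => 1 := by
  have hnorm : ‖gridVector 1 L (sqrtFun p)‖ = sqrtFun p (gridPoint L (0 : Fin d → Fin 1)) := by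
    rw [EuclideanSpace.norm_eq, Fintype.sum_subsingleton _ 0, Real.sqrt_sq (norm_nonneg _)]
    exact Complex.norm_of_nonneg (Real.sqrt_nonneg _)
  have hne := norm_ne_zero_iff.2 h
  rw [hnorm] at hne
  ext j
  rw [qsample_eq_smul, PiLp.smul_apply, Subsingleton.elim j 0, hnorm]
  simp [gridVector, hne]

theorem discreteHamiltonian_one (L : ℝ) (V : EuclideanSpace ℝ (Fin d) → ℝ) :
    discreteHamiltonian 1 L V = 0 := by
  have hcomm : matK d 1 L * matDV 1 L V = matDV 1 L V * matK d 1 L := by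
    ext i j
    rw [Matrix.mul_apply, Matrix.mul_apply, Fintype.sum_unique, Fintype.sum_unique,
      Subsingleton.elim i default, Subsingleton.elim j default, mul_comm]
  rw [discreteHamiltonian, hcomm, sub_self, smul_zero]

theorem SolvesSchrodinger.eq_of_grid_one {T : ℝ} (hT : 0 ≤ T)
    {V : ℝ → EuclideanSpace ℝ (Fin d) → ℝ} {φ : ℝ → EuclideanSpace ℂ (Fin d → Fin 1)}
    (hφ : SolvesSchrodinger T (fun t => discreteHamiltonian 1 L (V t)) φ) : φ T = φ 0 := by
  have hbound := (convex_Icc 0 T).norm_image_sub_le_of_norm_hasDerivWithin_le (C := 0) hφ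
    (fun t _ => by simp [discreteHamiltonian_one]) (Set.left_mem_Icc.2 hT) (Set.right_mem_Icc.2 hT)
  rwa [zero_mul, norm_le_zero_iff, sub_eq_zero] at hbound

theorem hasDerivWithinAt_gridVector_sqrtFun (N : ℕ) {T : ℝ}
    {p V : ℝ → EuclideanSpace ℝ (Fin d) → ℝ}
    (hp : ∀ t ∈ Set.Icc 0 T, IsTorusPDF L (p t)) (hcont : ContinuityEquation T p V)
    (hpC : ∀ t ∈ Set.Icc 0 T, IsTorusCk L (2 * (s + 1)) (sqrtFun (p t)))
    (hVC : ∀ t ∈ Set.Icc 0 T, IsTorusCk L (2 * (s + 1)) (V t))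
    (hVt : ∀ x, ContinuousOn (fun t => V t x) (Set.Icc 0 T))
    (hpt : ∀ x, ContinuousOn (fun t => Laplacian.laplacian (sqrtFun (p t)) x) (Set.Icc 0 T))
    (hVpt : ∀ x, ContinuousOn
      (fun t => Laplacian.laplacian (fun y => V t y * sqrtFun (p t) y) x) (Set.Icc 0 T))
    {t : ℝ} (ht : t ∈ Set.Icc 0 T) :
    HasDerivWithinAt (fun t => gridVector N L (sqrtFun (p t)))
      (gridVector N L (flowRate (V t) (sqrtFun (p t)))) (Set.Icc 0 T) t :=
  hasDerivWithinAt_gridVector fun x => hasDerivWithinAt_sqrtFun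
    (fun τ hτ => (hp τ hτ).2.1) hcont (fun τ hτ => ((hpC τ hτ).of_le (m := 2) (by omega)).2)
    (fun τ hτ => ((hVC τ hτ).of_le (m := 2) (by omega)).2) hVt hpt hVpt ht x

theorem norm_qsample_sub_le_of_even [NeZero N] (hN : Even N) {T : ℝ} (hL : 0 < L) (hT : 0 ≤ T)
    (hs : d < 4 * s) {p V : ℝ → EuclideanSpace ℝ (Fin d) → ℝ}
    (hp : ∀ t ∈ Set.Icc 0 T, IsTorusPDF L (p t)) (hcont : ContinuityEquation T p V)
    (hpC : ∀ t ∈ Set.Icc 0 T, IsTorusCk L (2 * (s + 1)) (sqrtFun (p t)))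
    (hVC : ∀ t ∈ Set.Icc 0 T, IsTorusCk L (2 * (s + 1)) (V t))
    (hVt : ∀ x, ContinuousOn (fun t => V t x) (Set.Icc 0 T))
    (hpt : ∀ x, ContinuousOn (fun t => Laplacian.laplacian (sqrtFun (p t)) x) (Set.Icc 0 T))
    (hVpt : ∀ x, ContinuousOn
      (fun t => Laplacian.laplacian (fun y => V t y * sqrtFun (p t) y) x) (Set.Icc 0 T))
    {φ : ℝ → EuclideanSpace ℂ (Fin d → Fin N)}
    (hφ : SolvesSchrodinger T (fun t => discreteHamiltonian N L (V t)) φ) {ε : ℝ}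
    (hV : ∀ t ∈ Set.Icc 0 T, (3 * errorDensity L s (p t) (V t) + 1) * (L / N) ^ (2 * s) ≤ ε)
    (hε : ε ≤ 1) : ‖qsample N L (p T) - φ T‖ ≤ ‖qsample N L (p 0) - φ 0‖ + T * ε := by
  rw [qsample_eq_smul, qsample_eq_smul]
  refine norm_inv_norm_smul_sub_le hT
    (A := fun t => discreteGenerator N L (V t)) (u := fun t => gridVector N L (sqrtFun (p t)))
    (e := fun t => gridVector N L (flowRate (V t) (sqrtFun (p t))) -
      discreteGenerator N L (V t) (gridVector N L (sqrtFun (p t))))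
    (fun t => inner_discreteGenerator (V t)) (fun t ht => ?_) hφ
    (fun t ht => gridVector_sqrtFun_ne_zero hL hs (hp t ht) (hpC t ht) ((hV t ht).trans hε))
    fun t ht => ?_
  · rw [add_sub_cancel]
    exact hasDerivWithinAt_gridVector_sqrtFun N hp hcont hpC hVC hVt hpt hVpt ht
  · refine (norm_gridVector_flowRate_sqrtFun_sub_le hN hL hs (hp t ht) (hpC t ht) (hVC t ht)
      ((hV t ht).trans hε)).trans (mul_le_mul_of_nonneg_right (le_trans ?_ (hV t ht))
        (norm_nonneg _))
    gcongr
    exact le_add_of_nonneg_right zero_le_one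

theorem div_pow_le_mul_div_pow (hL : 0 ≤ L) (hd : 1 ≤ d) (N k : ℕ) :
    (L / N) ^ k ≤ (L * d / N) ^ k := by
  gcongr
  exact le_mul_of_one_le_right hL (Nat.one_le_cast.2 hd)

theorem eq_one_or_even_two_pow (m : ℕ) : 2 ^ m = 1 ∨ Even (2 ^ m) := by
  cases m with
  | zero => exact .inl rfl
  | succ m => exact .inr (even_two.pow_of_ne_zero m.succ_ne_zero)

end WavefunctionFlow

end

open WavefunctionFlow in
theorem theorem1_general {d : ℕ} {L T : ℝ} (hL : 0 < L) (hT : 0 < T)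
    {N : ℕ} [NeZero N] (hN : N = 1 ∨ Even N) {s : ℕ} (hs : (d : ℝ) / 4 < s)
    {p V : ℝ → EuclideanSpace ℝ (Fin d) → ℝ}
    (hp : ∀ t ∈ Set.Icc 0 T, IsTorusPDF L (p t))
    (hcont : ContinuityEquation T p V)
    (hpC : ∀ t ∈ Set.Icc 0 T, IsTorusCk L (2 * (s + 1)) (sqrtFun (p t)))
    (hVC : ∀ t ∈ Set.Icc 0 T, IsTorusCk L (2 * (s + 1)) (V t))
    (hVt : ∀ x, ContinuousOn (fun t => V t x) (Set.Icc 0 T))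
    (hpt : ∀ x, ContinuousOn (fun t => Laplacian.laplacian (sqrtFun (p t)) x) (Set.Icc 0 T))
    (hVpt : ∀ x, ContinuousOn
      (fun t => Laplacian.laplacian (fun y => V t y * sqrtFun (p t) y) x) (Set.Icc 0 T))
    (hbdd : BddAbove ((fun t => errorDensity L s (p t) (V t)) '' Set.Icc 0 T))
    {φ : ℝ → EuclideanSpace ℂ (Fin d → Fin N)}
    (hφ : SolvesSchrodinger T (fun t => discreteHamiltonian N L (V t)) φ) {δ : ℝ}
    (hδ : ‖qsample N L (p 0) - φ 0‖ + T * errorConst L T s p V * (L / N) ^ (2 * s) ≤ δ)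
    (hδT : δ ≤ T) :
    (∀ t ∈ Set.Icc 0 T, ‖qsample N L (p t)‖ = 1) ∧ ‖qsample N L (p T) - φ T‖ ≤ δ := by
  replace hs : d < 4 * s := by exact_mod_cast (div_lt_iff₀' four_pos).1 hs
  have hc := one_le_errorConst L T s p V
  have hcX : errorConst L T s p V * (L / N) ^ (2 * s) ≤ 1 :=
    le_of_mul_le_mul_left (by linarith [norm_nonneg (qsample N L (p 0) - φ 0)]) hT
  have hcoeff (t : ℝ) (ht : t ∈ Set.Icc 0 T) : (3 * errorDensity L s (p t) (V t) + 1) *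
      (L / N) ^ (2 * s) ≤ errorConst L T s p V * (L / N) ^ (2 * s) := by
    gcongr
    exact three_mul_errorDensity_add_one_le_errorConst hbdd ht
  have hne (t : ℝ) (ht : t ∈ Set.Icc 0 T) : gridVector N L (sqrtFun (p t)) ≠ 0 :=
    gridVector_sqrtFun_ne_zero hL hs (hp t ht) (hpC t ht) ((hcoeff t ht).trans hcX)
  refine ⟨fun t ht => norm_qsample (hne t ht), le_trans ?_ hδ⟩
  rcases hN with rfl | hN
  · rw [qsample_one (hne T (Set.right_mem_Icc.2 hT.le)), hφ.eq_of_grid_one hT.le,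
      qsample_one (hne 0 (Set.left_mem_Icc.2 hT.le))]
    exact le_add_of_nonneg_right (by positivity)
  · rw [mul_assoc]
    exact norm_qsample_sub_le_of_even hN hL hT.le hs hp hcont hpC hVC hVt hpt hVpt hφ hcoeff hcX

open WavefunctionFlow in
theorem theorem1 (d : ℕ) (hd : 1 ≤ d) (L T : ℝ) (hL : 0 < L) (hT : 0 < T)
    (N : ℕ) (hN : ∃ m : ℕ, N = 2 ^ m)
    (s : ℕ) (hs : ((d : ℝ) + 7) / 4 ≤ (s : ℝ))
    (p V : ℝ → EuclideanSpace ℝ (Fin d) → ℝ)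
    (hp : ∀ t ∈ Set.Icc 0 T, IsTorusPDF L (p t))
    (hcont : ContinuityEquation T p V)
    (hpC : ∀ t ∈ Set.Icc 0 T, IsTorusCk L (2 * (s + 1)) (sqrtFun (p t)))
    (hVC : ∀ t ∈ Set.Icc 0 T, IsTorusCk L (2 * (s + 1)) (V t))
    (hVt : ∀ x, ContinuousOn (fun t => V t x) (Set.Icc 0 T))
    (hpt : ∀ x, ContinuousOn
      (fun t => Laplacian.laplacian (sqrtFun (p t)) x) (Set.Icc 0 T))
    (hVpt : ∀ x, ContinuousOn
      (fun t => Laplacian.laplacian (fun y => V t y * sqrtFun (p t) y) x) (Set.Icc 0 T))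
    (hbdd : BddAbove ((fun t => errorDensity L s (p t) (V t)) '' Set.Icc 0 T))
    (φ : ℝ → EuclideanSpace ℂ (Fin d → Fin N))
    (hφ : SolvesSchrodinger T (fun t => discreteHamiltonian N L (V t)) φ)
    (δ : ℝ)
    (hδ : δ = ‖qsample N L (p 0) - φ 0‖ +
      T * errorConst L T s p V * (L * d / N) ^ (2 * s))
    (hδT : δ ≤ T) :
    (∀ t ∈ Set.Icc 0 T, ‖qsample N L (p t)‖ = 1) ∧
      ‖qsample N L (p T) - φ T‖ ≤ δ := by
  obtain ⟨m, rfl⟩ := hN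
  have hc := zero_le_one.trans (one_le_errorConst L T s p V)
  refine theorem1_general hL hT (eq_one_or_even_two_pow m) (by linarith)
    hp hcont hpC hVC hVt hpt hVpt hbdd hφ (hδ ▸ ?_) hδT
  gcongr ‖_ - _‖ + T * _ * ?_
  exact div_pow_le_mul_div_pow hL.le hd _ _
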